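/- Let $L^2_+(\mathbb R)$ be the Hardy space of functions in $L^2(\mathbb R)$ whose Fourier transform is supported in $[0,\infty)$, let $C_+$ be the orthogonal projection of $L^2(\mathbb R)$ onto $L^2_+(\mathbb R)$, and put $\langle x\rangle=(1+x^2)^{1/2}$. Let $s>0$ and let $q\in L^2_{s,+}(\mathbb R)=\{f\in L^2_+(\mathbb R):\langle x\rangle^s f\in L^2(\mathbb R)\}$. Let $L_q=-i\partial_x-qC_+\overline q$ in $L^2_+(\mathbb R)$, with domain $H^1_+(\mathbb R)=H^1(\mathbb R)\cap L^2_+(\mathbb R)$, and let $\sigma_{\rm p}(L_q)$ be the set of its eigenvalues. For $\lambda\in\mathbb R$ let $R_0(\lambda\pm0i)$ be convolution of $L^1$ functions with $G_{\lambda\pm 0i}(x)=\pm i e^{i\lambda x}\chi_{\mathbb R_\pm}(x)$, where $\mathbb R_\pm=\{x:\pm x>0\}$, and let $$\mathcal N_\pm=\{\lambda\in[0,\infty):\ \ker(1-C_+\overline q R_0(\lambda\pm0i)qC_+)\neq\{0\}\}.$$ Then the exceptional set $\mathcal N=\mathcal N_+=\mathcal N_-$ satisfies $$\mathcal N_+=\mathcal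 N_-=\sigma_{\rm p}(L_q)\cap[0,\infty).$$ Moreover, let $\lambda\in\mathbb R$ and let $\psi$ be a bounded, locally absolutely continuous function on $\mathbb R$ with $-i\psi'-qC_+(\overline q\psi)=\lambda\psi$ almost everywhere which tends to $0$ at $-\infty$ or at $+\infty$. Then for every $\varepsilon>0$ there is a constant $C$ such that $|\psi(x)|\le C\langle x\rangle^{-s-1/2+\varepsilon}$ for all $x\in\mathbb R$; furthermore $\psi\in L^2(\mathbb R)$, $\psi$ belongs to the domain $H^1_+(\mathbb R)$ of $L_q$, and $L_q\psi=\lambda\psi$ (so $\psi$ is an eigenfunction if $\psi\ne0$). -/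

import Mathlib

open MeasureTheory Filter Topology Set
open scoped FourierTransform ENNReal ComplexConjugate

noncomputable section

/-- The Hilbert space `L²(ℝ) = L²(ℝ; ℂ)` with respect to Lebesgue measure. -/
abbrev L2R : Type := Lp (α := ℝ) ℂ 2 (volume : Measure ℝ)

/-! ### The Hardy space and the Cauchy–Szegő projector -/

/-- The Hardy space `L²₊(ℝ)`: functions in `L²(ℝ)` whose Fourier transform is supported
in `[0, ∞)`. (The normalisation of the Fourier transform plays no role.) -/
def hardySpace : Submodule ℂ L2R where
  carrier := {f | ∀ᵐ ξ : ℝ, ξ < 0 → (𝓕 f : L2R) ξ = 0}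
  zero_mem' := by
    have h : (𝓕 (0 : L2R) : L2R) = 0 := (Lp.fourierTransformₗᵢ ℝ ℂ).map_zero
    have h0 := Lp.coeFn_zero ℂ 2 (volume : Measure ℝ)
    simp only [mem_ofPred_eq, h]
    filter_upwards [h0] with ξ hξ _
    simp [hξ]
  add_mem' := by
    intro f g hf hg
    have h : (𝓕 (f + g) : L2R) = 𝓕 f + 𝓕 g := (Lp.fourierTransformₗᵢ ℝ ℂ).map_add f g
    simp only [mem_ofPred_eq, h] at hf hg ⊢
    filter_upwards [hf, hg, Lp.coeFn_add (𝓕 f : L2R) (𝓕 g)] with ξ h1 h2 h3 hξ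
    rw [h3, Pi.add_apply, h1 hξ, h2 hξ, add_zero]
  smul_mem' := by
    intro c f hf
    have h : (𝓕 (c • f) : L2R) = c • 𝓕 f := (Lp.fourierTransformₗᵢ ℝ ℂ).map_smul c f
    simp only [mem_ofPred_eq, h] at hf ⊢
    filter_upwards [hf, Lp.coeFn_smul c (𝓕 f : L2R)] with ξ h1 h3 hξ
    rw [h3, Pi.smul_apply, h1 hξ, smul_zero]

theorem mem_hardySpace_iff (f : L2R) :
    f ∈ hardySpace ↔ ∀ᵐ ξ : ℝ, ξ < 0 → (𝓕 f : L2R) ξ = 0 := Iff.rfl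

theorem isClosed_hardySpace : IsClosed (hardySpace : Set L2R) := by
  let T : L2R → Lp (α := ℝ) ℂ 2 (volume.restrict (Iio (0 : ℝ))) := fun f =>
    LpToLpRestrictCLM ℝ ℂ ℂ volume 2 (Iio (0 : ℝ)) (Lp.fourierTransformₗᵢ ℝ ℂ f)
  have hT : Continuous T :=
    (LpToLpRestrictCLM ℝ ℂ ℂ volume 2 (Iio (0 : ℝ))).continuous.comp
      (Lp.fourierTransformₗᵢ ℝ ℂ).continuous
  have h : (hardySpace : Set L2R) = T ⁻¹' {0} := by
    ext f
    have h1 : T f =ᵐ[volume.restrict (Iio (0 : ℝ))] ⇑(𝓕 f : L2R) :=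
      LpToLpRestrictCLM_coeFn ℂ (Iio (0 : ℝ)) (𝓕 f : L2R)
    rw [mem_preimage, mem_singleton_iff, Lp.eq_zero_iff_ae_eq_zero, SetLike.mem_coe,
      mem_hardySpace_iff]
    have h2 : (∀ᵐ ξ : ℝ, ξ < 0 → (𝓕 f : L2R) ξ = 0) ↔
        ∀ᵐ ξ ∂(volume.restrict (Iio (0 : ℝ))), (𝓕 f : L2R) ξ = 0 :=
      (ae_restrict_iff' measurableSet_Iio).symm
    rw [h2]
    constructor
    · intro h
      filter_upwards [h, h1] with ξ a b
      rw [b, a]; rfl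
    · intro h
      filter_upwards [h, h1] with ξ a b
      rw [← b, a]; rfl
  rw [h]
  exact isClosed_singleton.preimage hT

instance instCompleteSpaceHardySpace : CompleteSpace hardySpace :=
  isClosed_hardySpace.completeSpace_coe

/-- The Cauchy–Szegő projector `C₊`: the orthogonal projection of `L²(ℝ)` onto `L²₊(ℝ)`. -/
def cauchySzego : L2R →L[ℂ] L2R := hardySpace.starProjection

/-! ### The weighted spaces -/

/-- `⟨x⟩ = (1 + x²)^{1/2}`. -/
def japaneseBracket (x : ℝ) : ℝ := Real.sqrt (1 + x ^ 2)

/-- The class `L²_{s,+}(ℝ)` of those `f ∈ L²₊(ℝ)` for which `⟨x⟩ˢ f ∈ L²(ℝ)`. -/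
def weightedHardySpace (s : ℝ) : Set L2R :=
  {f | f ∈ hardySpace ∧ MemLp (fun x : ℝ => ((japaneseBracket x ^ s : ℝ) : ℂ) * f x) 2 volume}

/-! ### The Lax operator and its point spectrum -/

/-- A function on the line that is absolutely continuous on every compact interval. -/
def LocallyAC (ψ : ℝ → ℂ) : Prop := ∀ a b : ℝ, AbsolutelyContinuousOnInterval ψ a b

/-- For a locally absolutely continuous `ψ` with `q̄ψ ∈ L²(ℝ)`, this says that
`-iψ' - q C₊(q̄ψ) = w` almost everywhere; here `u` is the class of `q̄ψ` in `L²(ℝ)`. -/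
def HasLaxExpr (q : L2R) (ψ w : ℝ → ℂ) : Prop :=
  LocallyAC ψ ∧ ∃ u : L2R, (∀ᵐ x : ℝ, u x = conj (q x) * ψ x) ∧
    ∀ᵐ x : ℝ, -Complex.I * deriv ψ x - q x * cauchySzego u x = w x

/-- The function `φ` belongs to `H¹₊(ℝ) = H¹(ℝ) ∩ L²₊(ℝ)`, with `φ` being the (locally absolutely
continuous) continuous representative. -/
def MemH1Plus (φ : ℝ → ℂ) : Prop :=
  LocallyAC φ ∧ MemLp (deriv φ) 2 volume ∧ ∃ hφ : MemLp φ 2 volume, hφ.toLp φ ∈ hardySpace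

/-- The graph of the Lax operator `L_q = -i∂ₓ - q C₊ q̄` in `L²₊(ℝ)`, with domain `H¹₊(ℝ)`:
the set of all pairs `(f, L_q f)` with `f ∈ H¹₊(ℝ)`. -/
def laxGraph (q : L2R) : Set (L2R × L2R) :=
  {p | ∃ φ : ℝ → ℂ, MemH1Plus φ ∧ (∀ᵐ x : ℝ, p.1 x = φ x) ∧ HasLaxExpr q φ p.2}

/-- The point spectrum of `L_q`: the set of its eigenvalues. -/
def laxPointSpectrum (q : L2R) : Set ℂ :=
  {z | ∃ f : L2R, f ≠ 0 ∧ (f, z • f) ∈ laxGraph q}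

/-! ### The boundary values of the free resolvent and the exceptional sets -/

/-- The two sides of the real axis from which a boundary value at `λ` is taken: `above` stands
for `λ + 0i` and `below` for `λ - 0i`. -/
inductive BoundarySide where
  | above
  | below

/-- The sign `±1` of the side `λ ± 0i` of the cut. -/
def BoundarySide.sign : BoundarySide → ℝ
  | .above => 1
  | .below => -1

/-- The convolution kernel `G_{λ±0i}(x) = ± i e^{iλx} χ_{ℝ_±}(x)`, where `ℝ_± = {x : ±x > 0}`. -/
def greenKernel (σ : BoundarySide) (lam : ℝ) (x : ℝ) : ℂ :=
  if 0 < σ.sign * x then (σ.sign : ℂ) * Complex.I * Complex.exp (Complex.I * lam * x) else 0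

/-- The boundary value `R₀(λ±0i)` of the free resolvent, `f ↦ G_{λ±0i} * f` for `f ∈ L¹(ℝ)`. -/
def freeResolvent (σ : BoundarySide) (lam : ℝ) (f : ℝ → ℂ) (x : ℝ) : ℂ :=
  ∫ y : ℝ, greenKernel σ lam (x - y) * f y

theorem measurable_greenKernel (σ : BoundarySide) (lam : ℝ) :
    Measurable (greenKernel σ lam) := by
  unfold greenKernel
  refine Measurable.ite ?_ (by fun_prop) measurable_const
  exact measurableSet_lt measurable_const (by fun_prop)

theorem norm_greenKernel_le (σ : BoundarySide) (lam x : ℝ) : ‖greenKernel σ lam x‖ ≤ 1 := by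
  unfold greenKernel
  split_ifs
  · have h : Complex.I * lam * x = ((lam * x : ℝ) : ℂ) * Complex.I := by push_cast; ring
    rw [h, norm_mul, Complex.norm_exp_ofReal_mul_I]
    cases σ <;> simp [BoundarySide.sign]
  · simp

theorem integrable_greenKernel_mul (σ : BoundarySide) (lam x : ℝ) {f : ℝ → ℂ}
    (hf : Integrable f) : Integrable (fun y => greenKernel σ lam (x - y) * f y) := by
  refine hf.bdd_mul (c := 1) ?_ (Eventually.of_forall fun y => norm_greenKernel_le σ lam _)
  exact ((measurable_greenKernel σ lam).comp (by fun_prop)).aestronglyMeasurable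

theorem norm_freeResolvent_le (σ : BoundarySide) (lam x : ℝ) {f : ℝ → ℂ} (hf : Integrable f) :
    ‖freeResolvent σ lam f x‖ ≤ ∫ y, ‖f y‖ := by
  refine norm_integral_le_of_norm_le hf.norm (Eventually.of_forall fun y => ?_)
  rw [norm_mul]
  exact mul_le_of_le_one_left (norm_nonneg _) (norm_greenKernel_le σ lam _)

theorem aestronglyMeasurable_freeResolvent (σ : BoundarySide) (lam : ℝ) {f : ℝ → ℂ}
    (hf : Integrable f) : AEStronglyMeasurable (freeResolvent σ lam f) volume := by
  have h : AEStronglyMeasurable (fun p : ℝ × ℝ => greenKernel σ lam (p.1 - p.2) * f p.2)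
      (volume.prod volume) :=
    ((measurable_greenKernel σ lam).comp (by fun_prop)).aestronglyMeasurable.mul
      hf.aestronglyMeasurable.comp_snd
  exact h.integral_prod_right'

/-- The product of two functions in `L²(ℝ)` is integrable. -/
theorem integrable_mul_L2R (q g : L2R) : Integrable (fun x => q x * g x) :=
  (Lp.memLp q).integrable_mul (Lp.memLp g)

theorem memLp_conj_mul_freeResolvent (q : L2R) (σ : BoundarySide) (lam : ℝ) (g : L2R) :
    MemLp (fun x => conj (q x) * freeResolvent σ lam (fun y => q y * g y) x) 2 volume := by
  have hi := integrable_mul_L2R q g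
  have hq : MemLp (fun x => conj (q x)) 2 volume := (Lp.memLp q).star
  have hb : MemLp (freeResolvent σ lam (fun y => q y * g y)) ∞ volume :=
    memLp_top_of_bound (aestronglyMeasurable_freeResolvent σ lam hi) _
      (Eventually.of_forall fun x => norm_freeResolvent_le σ lam x hi)
  exact MemLp.mul hb hq

/-- The operator `q̄ R₀(λ±0i) q` on `L²(ℝ)`. -/
def sandwichedResolvent (q : L2R) (σ : BoundarySide) (lam : ℝ) : L2R →ₗ[ℂ] L2R where
  toFun g := (memLp_conj_mul_freeResolvent q σ lam g).toLp _
  map_add' g h := by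
    rw [← MemLp.toLp_add]
    refine MemLp.toLp_congr _ _ (Eventually.of_forall fun x => ?_)
    have e : freeResolvent σ lam (fun y => q y * (g + h : L2R) y) x =
        freeResolvent σ lam (fun y => q y * g y) x +
          freeResolvent σ lam (fun y => q y * h y) x := by
      unfold freeResolvent
      rw [← integral_add (integrable_greenKernel_mul σ lam x (integrable_mul_L2R q g))
        (integrable_greenKernel_mul σ lam x (integrable_mul_L2R q h))]
      refine integral_congr_ae ?_
      filter_upwards [Lp.coeFn_add g h] with y hy
      rw [hy, Pi.add_apply]; ring
    simp only [e, Pi.add_apply, mul_add]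
  map_smul' c g := by
    rw [RingHom.id_apply, ← MemLp.toLp_const_smul]
    refine MemLp.toLp_congr _ _ (Eventually.of_forall fun x => ?_)
    have e : freeResolvent σ lam (fun y => q y * (c • g : L2R) y) x =
        c * freeResolvent σ lam (fun y => q y * g y) x := by
      unfold freeResolvent
      rw [← integral_const_mul]
      refine integral_congr_ae ?_
      filter_upwards [Lp.coeFn_smul c g] with y hy
      rw [hy, Pi.smul_apply, smul_eq_mul]; ring
    simp only [e, Pi.smul_apply, smul_eq_mul]
    ring

/-- The operator `C₊ q̄ R₀(λ±0i) q C₊`. -/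
def boundaryOperator (q : L2R) (σ : BoundarySide) (lam : ℝ) : L2R →ₗ[ℂ] L2R :=
  cauchySzego.toLinearMap ∘ₗ sandwichedResolvent q σ lam ∘ₗ cauchySzego.toLinearMap

/-- The sets `𝒩_±` of those `λ ∈ [0, ∞)` with `ker (1 - C₊ q̄ R₀(λ±0i) q C₊) ≠ {0}`. -/
def exceptionalSet (q : L2R) (σ : BoundarySide) : Set ℝ :=
  {lam | 0 ≤ lam ∧ LinearMap.ker (1 - boundaryOperator q σ lam) ≠ ⊥}

/-- The set `𝒮(λ±0i)` of bounded, locally absolutely continuous solutions `ψ` of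
`-iψ' - q C₊(q̄ψ) = λψ` such that `ψ(x) → 0` as `x → ∓∞`. -/
def boundarySolutions (q : L2R) (σ : BoundarySide) (lam : ℝ) : Set (ℝ → ℂ) :=
  {ψ | (∃ M : ℝ, ∀ x, ‖ψ x‖ ≤ M) ∧ HasLaxExpr q ψ (fun x => lam * ψ x) ∧
    Tendsto (fun t : ℝ => ψ (-(σ.sign * t))) atTop (𝓝 0)}

end

open scoped SchwartzMap

noncomputable section

/-! ### Locally absolutely continuous functions -/

/-! For every real `λ`, kernel elements and eigenfunctions correspond through `ψ = R₀(λ±0i) q g`, `g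
= C₊ q̄ ψ`. From `g` in the kernel, this `ψ` is a bounded solution of the equation vanishing at one
end of the line. Conversely, an eigenfunction has the integrable source `q C₊ q̄ ψ` and is square
integrable, so it vanishes at both ends and equals `R₀(λ±0i)` of its source. What has to be shown is
that a bounded solution vanishing at one end lies in the domain of `L_q`, with the stated decay.

Energy: the derivative of `|ψ|²` is `-2 Im (ū C₊ u)` with `u = q̄ψ`. Its integral is zero because
`C₊` is self-adjoint, so `ψ` vanishes at both ends (`tendsto_zero_of_boundarySolution`).

Decay: then `|ψ(x)|` is at most the integral of `|q C₊ u|` over `|y| ≥ |x|`, and Cauchy–Schwarz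
bounds it by the `L²` tails of `q` and of `C₊ u`. The projector transports tail decay of order `ρ <
1/2`: on the Fourier side it nearly commutes with translation, up to the low frequencies, which a
fractional Hardy inequality controls. Iteration (`decay_improve`, `exists_decay`) raises the
exponent up to the cap `s + 1/2 - ε`; hence `ψ ∈ L²`.

Domain: the frequencies of `ψ` are nonnegative since those of `q C₊ u` are
(`LocallyAC.mem_hardySpace`). That `ψ' ∈ L²` is not immediate, since `q C₊ u` is a priori only in
`L¹`. For large `κ`, Hardy's inequality makes `C₊ q̄ (-i∂ₓ + iκ)⁻¹` small from `L²` to `L^∞`, so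
`L_q + iκ` can be inverted by a contraction with solutions in the range of `(-i∂ₓ + iκ)⁻¹`. By the
energy identity such solutions are unique in `L²`, so `ψ` is one of them (`LocallyAC.memLp_deriv`).
-/

theorem LocallyAC.continuous {ψ : ℝ → ℂ} (h : LocallyAC ψ) : Continuous ψ := by
  refine continuous_iff_continuousAt.2 fun x => ?_
  have hc := (h (x - 1) (x + 1)).continuousOn
  rw [uIcc_of_le (by linarith)] at hc
  exact hc.continuousAt (Icc_mem_nhds (by linarith) (by linarith))

theorem LocallyAC.add {φ ψ : ℝ → ℂ} (hφ : LocallyAC φ) (hψ : LocallyAC ψ) :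
    LocallyAC (fun x => φ x + ψ x) := fun a b => (hφ a b).add (hψ a b)

theorem LocallyAC.sub {φ ψ : ℝ → ℂ} (hφ : LocallyAC φ) (hψ : LocallyAC ψ) :
    LocallyAC (fun x => φ x - ψ x) := fun a b => (hφ a b).sub (hψ a b)

theorem LocallyAC.mul {φ ψ : ℝ → ℂ} (hφ : LocallyAC φ) (hψ : LocallyAC ψ) :
    LocallyAC (fun x => φ x * ψ x) := fun a b => (hφ a b).smul (hψ a b)

theorem ContDiff.locallyAC {φ : ℝ → ℂ} (hφ : ContDiff ℝ 1 φ) : LocallyAC φ :=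
  fun _ _ => hφ.contDiffOn.absolutelyContinuousOnInterval

theorem LocallyAC.conj {ψ : ℝ → ℂ} (hψ : LocallyAC ψ) : LocallyAC (fun x => conj (ψ x)) := by
  intro a b
  have h := hψ a b
  unfold AbsolutelyContinuousOnInterval at h ⊢
  simpa only [Complex.dist_conj_conj] using h

theorem LocallyAC.ae_differentiableAt {ψ : ℝ → ℂ} (h : LocallyAC ψ) :
    ∀ᵐ x : ℝ, DifferentiableAt ℝ ψ x := by
  have h1 : ∀ n : ℕ, ∀ᵐ x : ℝ, x ∈ uIcc (-(n : ℝ)) n → DifferentiableAt ℝ ψ x := fun n =>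
    (h (-(n : ℝ)) n).boundedVariationOn.ae_differentiableAt_of_mem_uIcc
  filter_upwards [ae_all_iff.2 h1] with x hx
  obtain ⟨n, hn⟩ := exists_nat_ge |x|
  refine hx n ?_
  rw [uIcc_of_le (by linarith [abs_nonneg x])]
  exact abs_le.1 hn

theorem locallyAC_intervalIntegral {f : ℝ → ℂ} (hf : LocallyIntegrable f) (c : ℝ) :
    LocallyAC (fun x => ∫ t in c..x, f t) := by
  have hint : ∀ x y, IntervalIntegrable f volume x y := fun x y =>
    (hf.integrableOn_isCompact isCompact_uIcc).intervalIntegrable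
  intro a b
  -- The interval is enlarged so as to contain the base point `c`; increments of the integral of `f`
  -- are dominated by those of the integral of `‖f‖`.
  have h1 : AbsolutelyContinuousOnInterval (fun x => ∫ t in c..x, ‖f t‖)
      (min (min a b) c) (max (max a b) c) := by
    refine (hint _ _).norm.absolutelyContinuousOnInterval_intervalIntegral ?_
    rw [uIcc_of_le (by simp)]
    simp
  have h2 : AbsolutelyContinuousOnInterval (fun x => ∫ t in c..x, ‖f t‖) a b := by
    refine h1.mono ?_
    rw [uIcc_of_le (by simp : min (min a b) c ≤ max (max a b) c), uIcc]
    exact Icc_subset_Icc (min_le_left _ _) (le_max_left _ _)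
  refine squeeze_zero (fun E => Finset.sum_nonneg fun _ _ => dist_nonneg)
    (fun E => Finset.sum_le_sum fun i _ => ?_) h2
  rw [dist_comm, dist_comm (∫ t in c..(E.2 i).1, ‖f t‖), dist_eq_norm, dist_eq_norm,
    intervalIntegral.integral_interval_sub_left (hint _ _) (hint _ _),
    intervalIntegral.integral_interval_sub_left (hint _ _).norm (hint _ _).norm]
  exact intervalIntegral.norm_integral_le_abs_integral_norm

/-- Subtracting the primitive of `f` leaves an absolutely continuous function with derivative zero
almost everywhere, hence a constant. -/
theorem LocallyAC.integral_eq_sub {ψ f : ℝ → ℂ} (h : LocallyAC ψ) (hf : LocallyIntegrable f)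
    (hd : ∀ᵐ x : ℝ, deriv ψ x = f x) (a b : ℝ) : ∫ x in a..b, f x = ψ b - ψ a := by
  have hg : LocallyAC (fun x => ψ x - ∫ t in a..x, f t) := h.sub (locallyAC_intervalIntegral hf a)
  obtain ⟨C, hC⟩ := (hg a b).const_of_ae_hasDerivAt_zero (by
    filter_upwards [h.ae_differentiableAt, LocallyIntegrable.ae_hasDerivAt_integral hf, hd] with x h1 h2 h3 _
    have := h1.hasDerivAt.sub (h2 a)
    rwa [h3, sub_self] at this)
  have h1 := hC a (by simp)
  have h2 := hC b (by simp)
  simp only [intervalIntegral.integral_same, sub_zero] at h1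
  rw [← h1] at h2
  rw [← h2]; ring

theorem contDiff_cexp_mul (z : ℂ) : ContDiff ℝ 1 (fun x : ℝ => Complex.exp (z * x)) := by
  have : ContDiff ℝ 1 (fun x : ℝ => (x : ℂ)) := Complex.ofRealCLM.contDiff
  fun_prop

theorem hasDerivAt_cexp_mul (z : ℂ) (x : ℝ) :
    HasDerivAt (fun x : ℝ => Complex.exp (z * x)) (z * Complex.exp (z * x)) x := by
  have h := ((Complex.ofRealCLM.hasDerivAt (x := x)).const_mul z).cexp
  simpa [mul_comm] using h

/-- Duhamel's formula for `-iψ' = zψ + F`. -/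
theorem LocallyAC.duhamel {ψ F : ℝ → ℂ} {z : ℂ} (h : LocallyAC ψ) (hF : LocallyIntegrable F)
    (hd : ∀ᵐ x : ℝ, deriv ψ x = Complex.I * (z * ψ x + F x)) (a b : ℝ) :
    ∫ x in a..b, Complex.exp (-(Complex.I * z) * x) * (Complex.I * F x) =
      Complex.exp (-(Complex.I * z) * b) * ψ b - Complex.exp (-(Complex.I * z) * a) * ψ a := by
  refine ((contDiff_cexp_mul _).locallyAC.mul h).integral_eq_sub
    ((hF.continuous_mul continuous_const).continuous_mul (contDiff_cexp_mul _).continuous) ?_ a b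
  filter_upwards [h.ae_differentiableAt, hd] with x h1 h2
  rw [((hasDerivAt_cexp_mul _ x).fun_mul h1.hasDerivAt).deriv, h2]
  ring

/-- Converse of Duhamel's formula; the equations for the free and the damped resolvents are read off
from their integral representations with it. -/
theorem locallyAC_of_duhamel {ψ F : ℝ → ℂ} {z c : ℂ} (hF : LocallyIntegrable F)
    (h : ∀ x, ψ x = Complex.exp (Complex.I * z * x) *
      (c + ∫ y in (0 : ℝ)..x, Complex.exp (-(Complex.I * z) * y) * (Complex.I * F y))) :
    LocallyAC ψ ∧ ∀ᵐ x : ℝ, deriv ψ x = Complex.I * (z * ψ x + F x) := by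
  have hG := (hF.continuous_mul (g := fun _ => Complex.I) continuous_const).continuous_mul
    (contDiff_cexp_mul (-(Complex.I * z))).continuous
  have hψ : ψ = fun x : ℝ => Complex.exp (Complex.I * z * x) *
      (c + ∫ y in (0 : ℝ)..x, Complex.exp (-(Complex.I * z) * y) * (Complex.I * F y)) := funext h
  refine ⟨?_, ?_⟩
  · rw [hψ]
    exact (contDiff_cexp_mul _).locallyAC.mul
      ((contDiff_const (c := c)).locallyAC.add (locallyAC_intervalIntegral hG 0))
  · filter_upwards [LocallyIntegrable.ae_hasDerivAt_integral hG] with x hx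
    have h1 := (hasDerivAt_cexp_mul (Complex.I * z) x).mul ((hx 0).const_add c)
    have h2 : Complex.exp (Complex.I * z * x) * Complex.exp (-(Complex.I * z) * x) = 1 := by
      rw [← Complex.exp_add]; simp
    rw [(h1.congr_of_eventuallyEq (.of_forall h)).deriv, h x]
    linear_combination (Complex.I * F x) * h2

/-! ### The Fourier transform on `L²(ℝ)` -/

theorem integral_mul_fourier (u : L2R) (g : 𝓢(ℝ, ℂ)) :
    ∫ x, g x * (𝓕 u : L2R) x = ∫ x, (𝓕 g : 𝓢(ℝ, ℂ)) x * u x := by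
  have h := DFunLike.congr_fun (Lp.fourier_toTemperedDistribution_eq u) g
  rw [TemperedDistribution.fourier_apply] at h
  simpa [Lp.toTemperedDistribution_apply] using h.symm

theorem MeasureTheory.MemLp.locallyIntegrable_of_two {f : ℝ → ℂ} (hf : MemLp f 2 volume) :
    LocallyIntegrable f := hf.locallyIntegrable (by norm_num)

theorem ae_eq_zero_of_forall_integral_schwartz_mul {U : Set ℝ} (hU : IsOpen U) {v : ℝ → ℂ}
    (hv : LocallyIntegrable v)
    (h : ∀ g : 𝓢(ℝ, ℂ), HasCompactSupport g → tsupport g ⊆ U → ∫ x, g x * v x = 0) :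
    ∀ᵐ x : ℝ, x ∈ U → v x = 0 := by
  refine hU.ae_eq_zero_of_integral_contDiff_smul_eq_zero (hv.locallyIntegrableOn U) ?_
  intro g hg hgc hgU
  have hc : HasCompactSupport (fun x => (g x : ℂ)) := hgc.comp_left Complex.ofReal_zero
  have hs : ContDiff ℝ (⊤ : ℕ∞) (fun x => (g x : ℂ)) := Complex.ofRealCLM.contDiff.comp hg
  have := h (hc.toSchwartzMap hs) hc (by
    refine (closure_mono ?_).trans hgU
    intro x hx
    simpa using hx)
  simpa using this

/-- The `L²` transform has no pointwise formula, so it is identified by duality. Modulations,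
conjugates and integrable functions are all treated this way. -/
theorem fourier_ae_eq_of_forall_schwartz {U : Set ℝ} (hU : IsOpen U) {u : L2R} {v : ℝ → ℂ}
    (hv : LocallyIntegrable v)
    (h : ∀ g : 𝓢(ℝ, ℂ), HasCompactSupport g → tsupport g ⊆ U →
      ∫ x, g x * v x = ∫ x, (𝓕 g : 𝓢(ℝ, ℂ)) x * u x) :
    ∀ᵐ x : ℝ, x ∈ U → (𝓕 u : L2R) x = v x := by
  have hu := (Lp.memLp (𝓕 u : L2R)).locallyIntegrable_of_two
  have := ae_eq_zero_of_forall_integral_schwartz_mul hU (hu.sub hv) (by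
    intro g hgc hgU
    have e : ∀ x, g x * ((𝓕 u : L2R) - v : ℝ → ℂ) x = g x * (𝓕 u : L2R) x - g x * v x :=
      fun x => by rw [Pi.sub_apply]; ring
    simp only [e]
    rw [integral_sub, integral_mul_fourier, h g hgc hgU, sub_self]
    · simpa using hu.integrable_smul_left_of_hasCompactSupport g.continuous hgc
    · simpa using hv.integrable_smul_left_of_hasCompactSupport g.continuous hgc)
  filter_upwards [this] with x hx hxU
  exact sub_eq_zero.1 (hx hxU)

theorem fourier_sub_L2R (f g : L2R) : (𝓕 (f - g) : L2R) = 𝓕 f - 𝓕 g :=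
  (Lp.fourierTransformₗᵢ ℝ ℂ).map_sub f g

theorem inner_L2R (f g : L2R) : inner ℂ f g = ∫ x, conj (f x) * g x := by
  rw [L2.inner_def]
  refine integral_congr_ae (Eventually.of_forall fun x => ?_)
  simp [mul_comm]

theorem norm_sq_L2R (f : L2R) : ‖f‖ ^ 2 = ∫ x, ‖f x‖ ^ 2 := by
  have h : RCLike.re (inner ℂ f f) = ‖f‖ ^ 2 := inner_self_eq_norm_sq f
  have e : ∀ x, conj (f x) * f x = ((‖f x‖ ^ 2 : ℝ) : ℂ) := fun x => by
    rw [Complex.conj_mul']; push_cast; rfl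
  rw [inner_L2R] at h
  simp only [e] at h
  rw [integral_complex_ofReal] at h
  exact h.symm

theorem memLp_indicator_fourier (u : L2R) :
    MemLp ((Ici (0 : ℝ)).indicator (𝓕 u : L2R)) 2 volume :=
  (Lp.memLp _).indicator measurableSet_Ici

/-- The Cauchy–Szegő projector is the Fourier multiplier with symbol `1_{[0,∞)}`. -/
theorem fourier_cauchySzego (u : L2R) :
    ∀ᵐ ξ : ℝ, (𝓕 (cauchySzego u) : L2R) ξ = (Ici (0 : ℝ)).indicator (𝓕 u : L2R) ξ := by
  set v : L2R := (memLp_indicator_fourier u).toLp _ with hv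
  have hvc := (memLp_indicator_fourier u).coeFn_toLp
  have e : cauchySzego u = 𝓕⁻ v := by
    refine Submodule.eq_starProjection_of_mem_of_inner_eq_zero ?_ ?_
    · rw [mem_hardySpace_iff, FourierTransform.fourier_fourierInv_eq]
      filter_upwards [hvc] with ξ h1 h2
      rw [hv, h1, indicator_of_notMem (by simpa using h2)]
    · intro w hw
      rw [← Lp.inner_fourier_eq, fourier_sub_L2R,
        FourierTransform.fourier_fourierInv_eq, inner_L2R]
      rw [mem_hardySpace_iff] at hw
      refine integral_eq_zero_of_ae ?_
      filter_upwards [hvc, hw, Lp.coeFn_sub (𝓕 u : L2R) v] with ξ h1 h2 h3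
      rw [h3, Pi.sub_apply, hv, h1]
      by_cases h0 : ξ < 0
      · simp [h2 h0]
      · rw [indicator_of_mem (by simpa using h0)]; simp
  rw [e, FourierTransform.fourier_fourierInv_eq]
  exact hvc

theorem cauchySzego_mem (u : L2R) : cauchySzego u ∈ hardySpace :=
  Submodule.starProjection_apply_mem _ _

theorem cauchySzego_eq_self {u : L2R} (hu : u ∈ hardySpace) : cauchySzego u = u :=
  Submodule.starProjection_eq_self_iff.2 hu

theorem norm_cauchySzego_le (u : L2R) : ‖cauchySzego u‖ ≤ ‖u‖ :=
  Submodule.norm_starProjection_apply_le _ _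

/-- Self-adjointness of the projector enters the energy argument only through this reality: the
total flux of `‖ψ‖²` along the line is zero. -/
theorem inner_cauchySzego_self_im (u : L2R) : (inner ℂ u (cauchySzego u)).im = 0 := by
  have h1 : inner ℂ (cauchySzego u) u = inner ℂ u (cauchySzego u) :=
    Submodule.inner_starProjection_left_eq_right _ _ _
  rw [← inner_conj_symm] at h1
  exact Complex.conj_eq_iff_im.1 h1

theorem integral_mul_fourier_of_integrable {f g : ℝ → ℂ} (hf : Integrable f) (hg : Integrable g) :
    ∫ x, g x * 𝓕 f x = ∫ x, 𝓕 g x * f x := by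
  have h := VectorFourier.integral_fourierIntegral_smul_eq_flip (μ := volume) (ν := volume)
    (L := innerₗ ℝ) Real.continuous_fourierChar continuous_inner hg hf
  rw [flip_innerₗ] at h
  exact h.symm

theorem integral_mul_fourierInv_of_integrable {f g : ℝ → ℂ} (hf : Integrable f)
    (hg : Integrable g) : ∫ x, g x * 𝓕⁻ f x = ∫ x, 𝓕⁻ g x * f x := by
  have h := integral_mul_fourier_of_integrable hf hg.comp_neg
  rw [← Real.fourierInv_eq_fourier_comp_neg, ← integral_neg_eq_self] at h
  simpa only [neg_neg, Real.fourierInv_eq_fourier_neg] using h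

/-- The `L²` and `L¹` Fourier transforms agree on `L¹ ∩ L²`. -/
theorem fourier_ae_eq_of_integrable {u : L2R} (hu : Integrable u) :
    ∀ᵐ ξ : ℝ, (𝓕 u : L2R) ξ = 𝓕 (u : ℝ → ℂ) ξ := by
  have hc : Continuous (𝓕 (u : ℝ → ℂ)) :=
    VectorFourier.fourierIntegral_continuous Real.continuous_fourierChar continuous_inner hu
  have := fourier_ae_eq_of_forall_schwartz isOpen_univ (u := u) hc.locallyIntegrable
    (fun g _ _ => integral_mul_fourier_of_integrable hu g.integrable)
  simpa using this

/-- By duality `w` agrees almost everywhere with the pointwise inverse transform of `𝓕 w`. This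
converts `L¹` bounds in frequency into supremum bounds for `cauchySzego u`. -/
theorem norm_le_integral_norm_fourier {w : L2R} (hw : Integrable (𝓕 w : L2R)) :
    ∀ᵐ x : ℝ, ‖w x‖ ≤ ∫ ξ, ‖(𝓕 w : L2R) ξ‖ := by
  set v : ℝ → ℂ := 𝓕⁻ ((𝓕 w : L2R) : ℝ → ℂ) with hv
  have hvc : Continuous v := by
    have hc : Continuous (𝓕 ((𝓕 w : L2R) : ℝ → ℂ)) :=
      VectorFourier.fourierIntegral_continuous Real.continuous_fourierChar continuous_inner hw
    have e : v = fun x => 𝓕 ((𝓕 w : L2R) : ℝ → ℂ) (-x) :=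
      funext fun x => Real.fourierInv_eq_fourier_neg _ x
    rw [e]
    exact hc.comp continuous_neg
  have hwl := (Lp.memLp w).locallyIntegrable_of_two
  have := ae_eq_zero_of_forall_integral_schwartz_mul isOpen_univ
    (hwl.sub hvc.locallyIntegrable) (by
    intro g hgc _
    have e : ∀ x, g x * ((w : ℝ → ℂ) - v) x = g x * w x - g x * v x :=
      fun x => by rw [Pi.sub_apply]; ring
    simp only [e]
    rw [integral_sub]
    · have h1 := integral_mul_fourier w (𝓕⁻ g)
      rw [FourierTransform.fourier_fourierInv_eq] at h1
      rw [← h1, hv, integral_mul_fourierInv_of_integrable hw g.integrable, sub_eq_zero]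
      rw [SchwartzMap.fourierInv_coe]
    · simpa using hwl.integrable_smul_left_of_hasCompactSupport g.continuous hgc
    · simpa using hvc.locallyIntegrable.integrable_smul_left_of_hasCompactSupport g.continuous hgc)
  filter_upwards [this] with x hx
  rw [sub_eq_zero.1 (hx (mem_univ x)), hv]
  rw [Real.fourierInv_eq]
  refine (norm_integral_le_integral_norm _).trans (le_of_eq ?_)
  simp

/-! ### Modulations and conjugation -/

theorem norm_cexp_I_mul (a x : ℝ) : ‖Complex.exp (2 * Real.pi * Complex.I * a * x)‖ = 1 := by
  have h : 2 * Real.pi * Complex.I * a * x = ((2 * Real.pi * a * x : ℝ) : ℂ) * Complex.I := by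
    push_cast; ring
  rw [h, Complex.norm_exp_ofReal_mul_I]

theorem memLp_modulate (h : ℝ) (u : L2R) :
    MemLp (fun x : ℝ => Complex.exp (2 * Real.pi * Complex.I * h * x) * u x) 2 volume := by
  refine (Lp.memLp u).of_le ?_ (Eventually.of_forall fun x => ?_)
  · exact (Continuous.aestronglyMeasurable (by fun_prop)).mul (Lp.aestronglyMeasurable u)
  · rw [norm_mul, norm_cexp_I_mul, one_mul]

/-- Multiplication by the character `x ↦ e^{2πihx}`. -/
def modulate (h : ℝ) (u : L2R) : L2R := (memLp_modulate h u).toLp _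

theorem coeFn_modulate (h : ℝ) (u : L2R) :
    ∀ᵐ x : ℝ, modulate h u x = Complex.exp (2 * Real.pi * Complex.I * h * x) * u x :=
  (memLp_modulate h u).coeFn_toLp

theorem MeasureTheory.MemLp.comp_sub_const {f : ℝ → ℂ} (hf : MemLp f 2 volume) (h : ℝ) :
    MemLp (fun x => f (x - h)) 2 volume :=
  hf.comp_measurePreserving (measurePreserving_sub_right volume h)

theorem fourier_modulate (h : ℝ) (u : L2R) :
    ∀ᵐ ξ : ℝ, (𝓕 (modulate h u) : L2R) ξ = (𝓕 u : L2R) (ξ - h) := by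
  have := fourier_ae_eq_of_forall_schwartz isOpen_univ (u := modulate h u)
    ((Lp.memLp (𝓕 u : L2R)).comp_sub_const h).locallyIntegrable_of_two (fun g _ _ => by
    have h1 := integral_mul_fourier u (g.compSubConstCLM ℂ (-h))
    have h2 := integral_add_right_eq_self (μ := volume) (fun x => g x * (𝓕 u : L2R) (x - h)) h
    rw [← h2]
    simp only [SchwartzMap.compSubConstCLM_apply, sub_neg_eq_add, add_sub_cancel_right] at h1 ⊢
    rw [h1]
    refine integral_congr_ae ?_
    filter_upwards [coeFn_modulate h u] with x hx
    have e : ∫ v : ℝ, Complex.exp (((-2 * Real.pi * v * x : ℝ) : ℂ) * Complex.I) • g (v + h) =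
        Complex.exp (2 * Real.pi * Complex.I * h * x) *
          ∫ v : ℝ, Complex.exp (((-2 * Real.pi * v * x : ℝ) : ℂ) * Complex.I) • g v := by
      rw [← integral_const_mul, ← integral_add_right_eq_self (μ := volume) (fun v : ℝ =>
        Complex.exp (2 * Real.pi * Complex.I * h * x) *
          Complex.exp (((-2 * Real.pi * v * x : ℝ) : ℂ) * Complex.I) • g v) h]
      refine integral_congr_ae (Eventually.of_forall fun y => ?_)
      simp only [smul_eq_mul]
      rw [← mul_assoc, ← Complex.exp_add]
      congr 2
      push_cast; ring
    rw [hx, SchwartzMap.fourier_coe, SchwartzMap.fourier_coe,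
      Real.fourier_real_eq_integral_exp_smul, Real.fourier_real_eq_integral_exp_smul]
    simp only [SchwartzMap.compSubConstCLM_apply, sub_neg_eq_add, e]
    ring)
  simpa using this

theorem memLp_conj (u : L2R) : MemLp (fun x => conj (u x)) 2 volume := (Lp.memLp u).star

theorem fourier_conj {u v : L2R} (h : ∀ᵐ x : ℝ, v x = conj (u x)) :
    ∀ᵐ ξ : ℝ, (𝓕 v : L2R) ξ = conj ((𝓕 u : L2R) (-ξ)) := by
  have hm : MemLp (fun ξ => conj ((𝓕 u : L2R) (-ξ))) 2 volume :=
    ((Lp.memLp (𝓕 u : L2R)).comp_measurePreserving (Measure.measurePreserving_neg volume)).star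
  have := fourier_ae_eq_of_forall_schwartz isOpen_univ (u := v)
    hm.locallyIntegrable_of_two (fun g _ _ => by
    set k : 𝓢(ℝ, ℂ) := SchwartzMap.compCLMOfContinuousLinearEquiv ℝ
      (ContinuousLinearEquiv.neg ℝ) (g.postcompCLM (Complex.conjCLE : ℂ →L[ℝ] ℂ)) with hk
    have hkx : ∀ x, k x = conj (g (-x)) := fun x => rfl
    have h1 := integral_mul_fourier u k
    rw [← integral_neg_eq_self (fun x => k x * (𝓕 u : L2R) x)] at h1
    simp only [hkx, neg_neg] at h1
    have h2 := congrArg conj h1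
    rw [← integral_conj, ← integral_conj] at h2
    simp only [map_mul, Complex.conj_conj] at h2
    rw [h2]
    refine integral_congr_ae ?_
    filter_upwards [h] with x hx
    rw [hx, SchwartzMap.fourier_coe, SchwartzMap.fourier_coe, Real.fourier_real_eq_integral_exp_smul,
      Real.fourier_real_eq_integral_exp_smul, ← integral_conj, ← integral_neg_eq_self]
    congr 1
    refine integral_congr_ae (Eventually.of_forall fun y => ?_)
    simp only [hkx, smul_eq_mul, neg_neg, map_mul, Complex.conj_conj, ← Complex.exp_conj,
      Complex.conj_ofReal, Complex.conj_I]
    congr 2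
    push_cast; ring)
  simpa using this

/-- The left side is the inner product of `modulate η a` with `b`; Parseval turns it into a
correlation of transforms, valid at every `η`. -/
theorem fourier_conj_mul_apply (a b : L2R) (η : ℝ) :
    𝓕 (fun x => conj (a x) * b x) η = ∫ ζ, conj ((𝓕 a : L2R) (ζ - η)) * (𝓕 b : L2R) ζ := by
  have h : inner ℂ (modulate η a) b = ∫ ζ, conj ((𝓕 a : L2R) (ζ - η)) * (𝓕 b : L2R) ζ := by
    rw [← Lp.inner_fourier_eq, inner_L2R]
    refine integral_congr_ae ?_
    filter_upwards [fourier_modulate η a] with ξ h1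
    rw [h1]
  rw [← h, inner_L2R, Real.fourier_real_eq_integral_exp_smul]
  refine integral_congr_ae ?_
  filter_upwards [coeFn_modulate η a] with x hx
  have e : conj (Complex.exp (2 * Real.pi * Complex.I * η * x)) =
      Complex.exp (((-2 * Real.pi * x * η : ℝ) : ℂ) * Complex.I) := by
    rw [← Complex.exp_conj]
    simp only [map_mul, Complex.conj_ofReal, Complex.conj_I, map_ofNat]
    congr 1
    push_cast; ring
  rw [hx, map_mul, e, smul_eq_mul, ← mul_assoc]

/-- The product of two functions in the Hardy space has no negative frequencies. -/
theorem fourier_mul_eq_zero_of_mem_hardySpace {q w : L2R} (hq : q ∈ hardySpace)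
    (hw : w ∈ hardySpace) {ξ : ℝ} (hξ : ξ < 0) : 𝓕 (fun x => q x * w x) ξ = 0 := by
  set a : L2R := (memLp_conj q).toLp _
  have ha : ∀ᵐ x : ℝ, a x = conj (q x) := (memLp_conj q).coeFn_toLp
  have h1 : 𝓕 (fun x => q x * w x) ξ = 𝓕 (fun x => conj (a x) * w x) ξ := by
    refine Real.fourier_congr_ae ?_ ξ
    filter_upwards [ha] with x hx
    rw [hx, Complex.conj_conj]
  rw [h1, fourier_conj_mul_apply]
  refine integral_eq_zero_of_ae ?_
  have h2 : ∀ᵐ ζ : ℝ, (𝓕 a : L2R) (ζ - ξ) = conj ((𝓕 q : L2R) (-(ζ - ξ))) :=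
    (measurePreserving_sub_right volume ξ).quasiMeasurePreserving.ae (fourier_conj ha)
  have h3 : ∀ᵐ ζ : ℝ, -(ζ - ξ) < 0 → (𝓕 q : L2R) (-(ζ - ξ)) = 0 :=
    (measurePreserving_sub_right volume ξ).quasiMeasurePreserving.ae
      ((Measure.measurePreserving_neg volume).quasiMeasurePreserving.ae
        ((mem_hardySpace_iff q).1 hq))
  filter_upwards [h2, h3, (mem_hardySpace_iff w).1 hw] with ζ h2 h3 h4
  -- The factor from `w` lives on `ζ ≥ 0`, the factor from `q` on `ζ ≤ ξ < 0`; these sets are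
  -- disjoint.
  rcases lt_or_ge ζ 0 with h0 | h0
  · simp [h4 h0]
  · rw [h2, h3 (by linarith)]; simp

/-! ### Integration by parts and the Fourier transform of solutions -/

/-- Integration by parts: a Schwartz function times a bounded one leaves no boundary terms. -/
theorem LocallyAC.integral_mul_deriv_schwartz {ψ d : ℝ → ℂ} {M : ℝ} (h : LocallyAC ψ)
    (hM : ∀ x, ‖ψ x‖ ≤ M) (hψd : ∀ᵐ x : ℝ, deriv ψ x = d x)
    (g : 𝓢(ℝ, ℂ)) (hgd : Integrable (fun x => g x * d x)) :
    ∫ x, deriv g x * ψ x = -∫ x, g x * d x := by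
  have hg : LocallyAC g := (g.smooth 1).locallyAC
  have hdψ : ∀ᵐ x : ℝ, deriv (fun x => g x * ψ x) x = deriv g x * ψ x + g x * d x := by
    filter_upwards [h.ae_differentiableAt, hψd] with x h1 h2
    rw [(g.differentiableAt.hasDerivAt.fun_mul h1.hasDerivAt).deriv, h2]
  have hi : Integrable (fun x => deriv g x * ψ x) := by
    have := (SchwartzMap.derivCLM ℂ ℂ g).integrable (μ := volume)
    exact this.mul_bdd h.continuous.aestronglyMeasurable (Eventually.of_forall hM)
  have hint := hi.add hgd
  have h0 : ∀ a b, ∫ x in a..b, (deriv g x * ψ x + g x * d x) = g b * ψ b - g a * ψ a :=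
    (hg.mul h).integral_eq_sub hint.locallyIntegrable hdψ
  have hb : Tendsto (fun x => g x * ψ x) (cocompact ℝ) (𝓝 0) := by
    have h1 := (g.tendsto_cocompact).norm.mul_const M
    rw [norm_zero, zero_mul] at h1
    refine squeeze_zero_norm (fun x => ?_) h1
    rw [norm_mul]
    exact mul_le_mul_of_nonneg_left (hM x) (norm_nonneg _)
  rw [cocompact_eq_atBot_atTop, tendsto_sup] at hb
  have h1 := intervalIntegral_tendsto_integral hint
    (tendsto_neg_atTop_atBot) (tendsto_id (α := ℝ) (x := atTop))
  have h2 : Tendsto (fun x : ℝ => g x * ψ x - g (-x) * ψ (-x)) atTop (𝓝 (0 - 0)) :=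
    hb.2.sub (hb.1.comp tendsto_neg_atTop_atBot)
  have h3 := tendsto_nhds_unique h1 (by simpa only [h0, Pi.add_apply, id] using h2)
  rw [sub_zero, Pi.add_def, integral_add hi hgd] at h3
  exact eq_neg_of_add_eq_zero_left h3

theorem hasTemperateGrowth_symbol (z : ℂ) :
    Function.HasTemperateGrowth (fun ξ : ℝ => 2 * Real.pi * (ξ : ℂ) - z) := by
  have h : Function.HasTemperateGrowth (fun ξ : ℝ => (ξ : ℂ)) :=
    Complex.ofRealCLM.hasTemperateGrowth
  fun_prop

/-- The operator `i∂ - z` on the right is the transpose of `-i∂ - z`, so integration by parts can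
move it onto a solution. -/
theorem fourier_symbol_mul (z : ℂ) (g : 𝓢(ℝ, ℂ)) (x : ℝ) :
    (𝓕 (SchwartzMap.smulLeftCLM ℂ (fun ξ : ℝ => 2 * Real.pi * (ξ : ℂ) - z) g) : 𝓢(ℝ, ℂ)) x =
      Complex.I * deriv (𝓕 g : 𝓢(ℝ, ℂ)) x - z * (𝓕 g : 𝓢(ℝ, ℂ)) x := by
  have h1 : Integrable (fun ξ : ℝ => ξ • g ξ) := by
    have := g.integrable_pow_mul volume 1
    refine (integrable_norm_iff (Continuous.aestronglyMeasurable (by fun_prop))).1 ?_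
    simpa [norm_smul] using this
  have h2 := (Real.hasDerivAt_fourier g.integrable h1 x).deriv
  rw [SchwartzMap.fourier_coe, SchwartzMap.fourier_coe, h2,
    Real.fourier_real_eq_integral_exp_smul, Real.fourier_real_eq_integral_exp_smul,
    Real.fourier_real_eq_integral_exp_smul, ← integral_const_mul, ← integral_const_mul,
    ← integral_sub]
  · refine integral_congr_ae (Eventually.of_forall fun y => ?_)
    simp only [SchwartzMap.smulLeftCLM_apply_apply (hasTemperateGrowth_symbol z), smul_eq_mul]
    linear_combination (2 * Real.pi * y * Complex.exp (((-2 * Real.pi * y * x : ℝ) : ℂ) * Complex.I) * g y) * Complex.I_sq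
  all_goals
    refine Integrable.const_mul ?_ _
    refine Integrable.bdd_mul (c := 1) ?_ (Continuous.aestronglyMeasurable (by fun_prop))
      (Eventually.of_forall fun y => by rw [Complex.norm_exp_ofReal_mul_I])
  · refine (h1.const_mul (-2 * Real.pi * Complex.I)).congr (Eventually.of_forall fun y => ?_)
    simp only [smul_eq_mul, Complex.real_smul]; ring
  · exact g.integrable

/-- If `-iψ' - zψ = f`, then `(2πξ - z) ψ̂(ξ) = f̂(ξ)`. -/
theorem LocallyAC.fourier_of_equation {ψ f F : ℝ → ℂ} {z : ℂ} {M : ℝ} {u : L2R} (h : LocallyAC ψ)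
    (hM : ∀ x, ‖ψ x‖ ≤ M) (hu : ∀ᵐ x : ℝ, u x = ψ x)
    (hfg : ∀ g : 𝓢(ℝ, ℂ), Integrable (fun x => g x * f x)) (hF : LocallyIntegrable F)
    (hd : ∀ᵐ x : ℝ, deriv ψ x = Complex.I * (z * ψ x + f x))
    (hfF : ∀ g : 𝓢(ℝ, ℂ), ∫ x, g x * F x = ∫ x, (𝓕 g : 𝓢(ℝ, ℂ)) x * f x) :
    ∀ᵐ ξ : ℝ, (2 * Real.pi * ξ - z) * (𝓕 u : L2R) ξ = F ξ := by
  -- Only the duality `hfF` is known about `F`, so that sources `f` in `L¹` and in `L²` are both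
  -- covered.
  have hl := (Lp.memLp (𝓕 u : L2R)).locallyIntegrable_of_two.continuous_mul
    (g := fun ξ : ℝ => 2 * Real.pi * (ξ : ℂ) - z) (by fun_prop)
  have hψg : ∀ g : 𝓢(ℝ, ℂ), Integrable (fun x => g x * ψ x) := fun g =>
    g.integrable.mul_bdd h.continuous.aestronglyMeasurable (Eventually.of_forall hM)
  have hψg' : ∀ g : 𝓢(ℝ, ℂ), Integrable (fun x => deriv g x * ψ x) := fun g =>
    (SchwartzMap.derivCLM ℂ ℂ g).integrable.mul_bdd h.continuous.aestronglyMeasurable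
      (Eventually.of_forall hM)
  have := ae_eq_zero_of_forall_integral_schwartz_mul isOpen_univ (hl.sub hF) (by
    intro g hgc _
    set g1 : 𝓢(ℝ, ℂ) := SchwartzMap.smulLeftCLM ℂ (fun ξ : ℝ => 2 * Real.pi * (ξ : ℂ) - z) g
    have e : ∀ ξ : ℝ, g ξ * ((fun ξ : ℝ => (2 * Real.pi * (ξ : ℂ) - z) * (𝓕 u : L2R) ξ) - F) ξ =
        g1 ξ * (𝓕 u : L2R) ξ - g ξ * F ξ := fun ξ => by
      simp only [g1, SchwartzMap.smulLeftCLM_apply_apply (hasTemperateGrowth_symbol z),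
        smul_eq_mul, Pi.sub_apply]
      ring
    simp only [e]
    have hgf := hfg (𝓕 g)
    have hi : Integrable (fun x => (𝓕 g : 𝓢(ℝ, ℂ)) x * (Complex.I * (z * ψ x + f x))) := by
      have := ((hψg (𝓕 g)).const_mul (Complex.I * z)).add (hgf.const_mul Complex.I)
      refine this.congr (Eventually.of_forall fun x => ?_)
      simp only [Pi.add_apply]; ring
    have h1 := h.integral_mul_deriv_schwartz hM (d := fun x => Complex.I * (z * ψ x + f x))
      hd (𝓕 g) hi
    rw [integral_sub, integral_mul_fourier, hfF]
    · have h2 : ∫ x, (𝓕 g1 : 𝓢(ℝ, ℂ)) x * u x = Complex.I * (∫ x, deriv (𝓕 g : 𝓢(ℝ, ℂ)) x * ψ x) -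
          z * ∫ x, (𝓕 g : 𝓢(ℝ, ℂ)) x * ψ x := by
        rw [← integral_const_mul, ← integral_const_mul, ← integral_sub
          ((hψg' _).const_mul _) ((hψg _).const_mul _)]
        refine integral_congr_ae ?_
        filter_upwards [hu] with x hx
        rw [hx, fourier_symbol_mul]; ring
      have h3 : ∫ x, (𝓕 g : 𝓢(ℝ, ℂ)) x * (Complex.I * (z * ψ x + f x)) =
          Complex.I * z * (∫ x, (𝓕 g : 𝓢(ℝ, ℂ)) x * ψ x) +
            Complex.I * ∫ x, (𝓕 g : 𝓢(ℝ, ℂ)) x * f x := by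
        rw [← integral_const_mul, ← integral_const_mul, ← integral_add
          ((hψg _).const_mul _) (hgf.const_mul _)]
        refine integral_congr_ae (Eventually.of_forall fun x => ?_)
        simp only; ring
      rw [h2, h1, h3]
      linear_combination (-z * (∫ x, (𝓕 g : 𝓢(ℝ, ℂ)) x * ψ x) -
        ∫ x, (𝓕 g : 𝓢(ℝ, ℂ)) x * f x) * Complex.I_sq
    · have := (g1.memLp 2).integrable_mul (Lp.memLp (𝓕 u : L2R))
      exact this
    · simpa using hF.integrable_smul_left_of_hasCompactSupport g.continuous hgc)
  filter_upwards [this] with x hx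
  exact sub_eq_zero.1 (hx (mem_univ x))

/-- The source `q w` has no negative frequencies, and the symbol `2πξ - λ` vanishes at a single
point, so it can be divided out almost everywhere. -/
theorem LocallyAC.mem_hardySpace {ψ : ℝ → ℂ} {lam M : ℝ} {q w u : L2R} (h : LocallyAC ψ)
    (hM : ∀ x, ‖ψ x‖ ≤ M) (hu : ∀ᵐ x : ℝ, u x = ψ x) (hq : q ∈ hardySpace) (hw : w ∈ hardySpace)
    (hd : ∀ᵐ x : ℝ, deriv ψ x = Complex.I * (lam * ψ x + q x * w x)) : u ∈ hardySpace := by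
  have hi := integrable_mul_L2R q w
  have hc : Continuous (𝓕 (fun x => q x * w x)) :=
    VectorFourier.fourierIntegral_continuous Real.continuous_fourierChar continuous_inner hi
  have h1 := h.fourier_of_equation hM hu (fun g => by
      have hg : ∃ C, ∀ x, ‖g x‖ ≤ C := ⟨_, fun x => g.norm_le_seminorm ℝ x⟩
      obtain ⟨C, hC⟩ := hg
      exact hi.bdd_mul g.continuous.aestronglyMeasurable (Eventually.of_forall hC))
    hc.locallyIntegrable hd (fun g => integral_mul_fourier_of_integrable hi g.integrable)
  have h2 : ∀ᵐ ξ : ℝ, ξ ≠ lam / (2 * Real.pi) := by simp [ae_iff, measure_singleton]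
  rw [mem_hardySpace_iff]
  filter_upwards [h1, h2] with ξ h1 h2 h3
  rw [fourier_mul_eq_zero_of_mem_hardySpace hq hw h3, mul_eq_zero] at h1
  refine h1.resolve_left fun h0 => h2 ?_
  have : 2 * Real.pi * ξ - lam = 0 := by exact_mod_cast h0
  rw [eq_div_iff (by positivity)]
  linarith

/-! ### The energy identity -/

/-- The integrand is `2 Re (χ̄ χ')`, rewritten by the equation and `χ̄ q = ū`. -/
theorem norm_sq_sub_norm_sq {χ : ℝ → ℂ} {z : ℂ} {q u : L2R} (h : LocallyAC χ)
    (hu : ∀ᵐ x : ℝ, u x = conj (q x) * χ x)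
    (hd : ∀ᵐ x : ℝ, deriv χ x = Complex.I * (z * χ x + q x * cauchySzego u x)) (a b : ℝ) :
    ∫ x in a..b, (-2 * z.im * ‖χ x‖ ^ 2 - 2 * (conj (u x) * cauchySzego u x).im) =
      ‖χ b‖ ^ 2 - ‖χ a‖ ^ 2 := by
  have hi : Integrable (fun x => conj (u x) * cauchySzego u x) :=
    MemLp.integrable_mul (memLp_conj u) (Lp.memLp (cauchySzego u))
  have hl : LocallyIntegrable (fun x =>
      ((-2 * z.im * ‖χ x‖ ^ 2 - 2 * (conj (u x) * cauchySzego u x).im : ℝ) : ℂ)) := by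
    have h1 : LocallyIntegrable (fun x => ((-2 * z.im * ‖χ x‖ ^ 2 : ℝ) : ℂ)) := by
      have := h.continuous
      exact Continuous.locallyIntegrable (by fun_prop)
    have h2 : Integrable (fun x => ((2 * (conj (u x) * cauchySzego u x).im : ℝ) : ℂ)) :=
      (hi.im.const_mul 2).ofReal
    refine (h1.sub h2.locallyIntegrable).congr (Eventually.of_forall fun x => ?_)
    simp
  have h1 := (h.conj.mul h).integral_eq_sub hl (by
    filter_upwards [h.ae_differentiableAt, hd, hu] with x h1 h2 h3
    have h4 : HasDerivAt (fun x => conj (χ x)) (conj (deriv χ x)) x := h1.hasDerivAt.star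
    rw [(h4.fun_mul h1.hasDerivAt).deriv, h2, h3]
    simp only [map_mul, map_add, Complex.conj_I, Complex.conj_conj]
    apply Complex.ext <;>
    simp [Complex.sq_norm, Complex.normSq_apply] <;> ring) a b
  have e : ∀ x, conj (χ x) * χ x = ((‖χ x‖ ^ 2 : ℝ) : ℂ) := fun x => by
    rw [Complex.conj_mul']; push_cast; rfl
  rw [e, e, intervalIntegral.integral_ofReal] at h1
  exact_mod_cast h1

theorem integral_im_conj_mul_cauchySzego (u : L2R) :
    ∫ x, (conj (u x) * cauchySzego u x).im = 0 := by
  have hi : Integrable (fun x => conj (u x) * cauchySzego u x) :=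
    MemLp.integrable_mul (memLp_conj u) (Lp.memLp (cauchySzego u))
  have h1 := integral_im (𝕜 := ℂ) hi
  rw [← inner_L2R] at h1
  exact h1.trans (inner_cauchySzego_self_im u)

/-- The modulus of a solution for a real spectral parameter has the same limits at `±∞`. -/
theorem tendsto_norm_sq_sub {ψ : ℝ → ℂ} {lam : ℝ} {q u : L2R} (h : LocallyAC ψ)
    (hu : ∀ᵐ x : ℝ, u x = conj (q x) * ψ x)
    (hd : ∀ᵐ x : ℝ, deriv ψ x = Complex.I * (lam * ψ x + q x * cauchySzego u x)) :
    Tendsto (fun t : ℝ => ‖ψ t‖ ^ 2 - ‖ψ (-t)‖ ^ 2) atTop (𝓝 0) := by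
  have hi : Integrable (fun x => conj (u x) * cauchySzego u x) :=
    MemLp.integrable_mul (memLp_conj u) (Lp.memLp (cauchySzego u))
  have h1 := intervalIntegral_tendsto_integral (hi.im.const_mul (-2))
    (tendsto_neg_atTop_atBot) (tendsto_id (α := ℝ) (x := atTop))
  have h2 := norm_sq_sub_norm_sq h hu hd
  rw [integral_const_mul, show (∫ x, RCLike.im (conj (u x) * cauchySzego u x)) = 0 from
    integral_im_conj_mul_cauchySzego u, mul_zero] at h1
  refine h1.congr fun t => ?_
  rw [← h2]
  refine intervalIntegral.integral_congr fun x _ => ?_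
  simp

theorem eq_zero_of_integrable_of_tendsto_atTop {f : ℝ → ℝ} {a : ℝ} (hf : Integrable f)
    (h : Tendsto f atTop (𝓝 a)) : a = 0 :=
  IntegrableAtFilter.eq_zero_of_tendsto (hf.integrableAtFilter _)
    (fun s hs => by
      obtain ⟨b, hb⟩ := mem_atTop_sets.1 hs
      exact measure_mono_top (fun x hx => hb x hx) (Real.volume_Ici (a := b))) h

theorem eq_zero_of_integrable_of_tendsto_atBot {f : ℝ → ℝ} {a : ℝ} (hf : Integrable f)
    (h : Tendsto f atBot (𝓝 a)) : a = 0 :=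
  IntegrableAtFilter.eq_zero_of_tendsto (hf.integrableAtFilter _)
    (fun s hs => by
      obtain ⟨b, hb⟩ := mem_atBot_sets.1 hs
      exact measure_mono_top (fun x hx => hb x hx) (Real.volume_Iic (a := b))) h

/-- The Lax operator has no spectrum off the real axis: square integrable solutions vanish. -/
theorem eq_zero_of_im_neg {χ : ℝ → ℂ} {κ : ℝ} (hκ : 0 < κ) {q u : L2R} (h : LocallyAC χ)
    (hχ : MemLp χ 2 volume) (hu : ∀ᵐ x : ℝ, u x = conj (q x) * χ x)
    (hd : ∀ᵐ x : ℝ, deriv χ x =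
      Complex.I * (-(Complex.I * κ) * χ x + q x * cauchySzego u x)) : χ = 0 := by
  have hi : Integrable (fun x => conj (u x) * cauchySzego u x) :=
    MemLp.integrable_mul (memLp_conj u) (Lp.memLp (cauchySzego u))
  have him : Integrable (fun x => (conj (u x) * cauchySzego u x).im) := hi.im
  have hs : Integrable (fun x => ‖χ x‖ ^ 2) := hχ.integrable_norm_pow (by norm_num)
  have hE : Integrable (fun x => 2 * κ * ‖χ x‖ ^ 2 - 2 * (conj (u x) * cauchySzego u x).im) :=
    (hs.const_mul _).sub (hi.im.const_mul 2)
  have h2 : ∀ a b, ∫ x in a..b, (2 * κ * ‖χ x‖ ^ 2 - 2 * (conj (u x) * cauchySzego u x).im) =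
      ‖χ b‖ ^ 2 - ‖χ a‖ ^ 2 := fun a b => by
    rw [← norm_sq_sub_norm_sq h hu hd]
    simp
  -- `‖χ‖²` has a limit because its derivative is integrable, and the limit is zero because `‖χ‖²`
  -- is integrable. With both ends zero, the energy identity leaves `2κ ∫ ‖χ‖² = 0`.
  have ht : Tendsto (fun x => ‖χ x‖ ^ 2) atTop (𝓝 0) := by
    have h3 := intervalIntegral_tendsto_integral_Ioi 0 hE.integrableOn (tendsto_id (α := ℝ))
    simp only [h2, id] at h3
    have h4 := h3.add_const (‖χ 0‖ ^ 2)
    simp only [sub_add_cancel] at h4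
    rwa [eq_zero_of_integrable_of_tendsto_atTop hs h4] at h4
  have hb : Tendsto (fun x => ‖χ x‖ ^ 2) atBot (𝓝 0) := by
    have h3 := intervalIntegral_tendsto_integral_Iic 0 hE.integrableOn (tendsto_id (α := ℝ))
    simp only [h2, id] at h3
    have h4 := h3.const_sub (‖χ 0‖ ^ 2)
    simp only [sub_sub_cancel] at h4
    rwa [eq_zero_of_integrable_of_tendsto_atBot hs h4] at h4
  have h3 := intervalIntegral_tendsto_integral hE
    (tendsto_neg_atTop_atBot) (tendsto_id (α := ℝ) (x := atTop))
  simp only [h2, id] at h3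
  have h4 := tendsto_nhds_unique h3 (ht.sub (hb.comp tendsto_neg_atTop_atBot))
  rw [integral_sub (hs.const_mul _) (him.const_mul 2), integral_const_mul, integral_const_mul,
    show (∫ x, (conj (u x) * cauchySzego u x).im) = 0 from
    integral_im_conj_mul_cauchySzego u, mul_zero, sub_zero, sub_zero] at h4
  have h5 : ∫ x, ‖χ x‖ ^ 2 = 0 := by
    rcases mul_eq_zero.1 h4 with h | h
    · linarith
    · exact h
  rw [integral_eq_zero_iff_of_nonneg (fun x => by positivity) hs] at h5
  have h7 := Continuous.ae_eq_iff_eq volume (h.continuous.norm.pow 2) continuous_const |>.1 h5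
  funext x
  have h8 : ‖χ x‖ ^ 2 = 0 := congrFun h7 x
  exact norm_eq_zero.1 ((pow_eq_zero_iff (by norm_num)).1 h8)

/-! ### The free resolvent -/

theorem freeResolvent_above (lam : ℝ) (F : ℝ → ℂ) (x : ℝ) :
    freeResolvent .above lam F x = Complex.exp (Complex.I * lam * x) *
      ∫ y in Iic x, Complex.exp (-(Complex.I * lam) * y) * (Complex.I * F y) := by
  rw [freeResolvent, ← integral_const_mul, integral_Iic_eq_integral_Iio,
    ← integral_indicator measurableSet_Iio]
  refine integral_congr_ae (Eventually.of_forall fun y => ?_)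
  by_cases hy : y < x
  · simp only [greenKernel, BoundarySide.sign, one_mul, sub_pos, hy, if_true, mem_Iio,
      indicator_of_mem]
    rw [← mul_assoc (Complex.exp _), ← Complex.exp_add]
    push_cast
    ring_nf
  · simp [greenKernel, BoundarySide.sign, hy]

theorem freeResolvent_below (lam : ℝ) (F : ℝ → ℂ) (x : ℝ) :
    freeResolvent .below lam F x = Complex.exp (Complex.I * lam * x) *
      -∫ y in Ioi x, Complex.exp (-(Complex.I * lam) * y) * (Complex.I * F y) := by
  rw [freeResolvent, ← integral_neg, ← integral_const_mul, ← integral_indicator measurableSet_Ioi]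
  refine integral_congr_ae (Eventually.of_forall fun y => ?_)
  by_cases hy : x < y
  · simp only [greenKernel, BoundarySide.sign, neg_mul, one_mul, neg_sub, sub_pos, hy, if_true,
      mem_Ioi, indicator_of_mem]
    rw [mul_neg, ← mul_assoc (Complex.exp _), ← Complex.exp_add]
    push_cast
    ring_nf
  · simp [greenKernel, BoundarySide.sign, hy]

theorem integrable_twist {F : ℝ → ℂ} (hF : Integrable F) (lam : ℝ) :
    Integrable (fun y : ℝ => Complex.exp (-(Complex.I * lam) * y) * (Complex.I * F y)) := by
  refine (hF.const_mul Complex.I).bdd_mul (c := 1)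
    (Continuous.aestronglyMeasurable (by fun_prop)) (Eventually.of_forall fun y => ?_)
  rw [show -(Complex.I * lam) * y = ((-(lam * y) : ℝ) : ℂ) * Complex.I by push_cast; ring,
    Complex.norm_exp_ofReal_mul_I]

theorem tendsto_of_side {f : ℝ → ℂ} {a : ℂ} (σ : BoundarySide) :
    Tendsto (fun t : ℝ => f (-(σ.sign * t))) atTop (𝓝 a) ↔
      Tendsto f (match σ with | .above => atBot | .below => atTop) (𝓝 a) := by
  cases σ
  · simp only [BoundarySide.sign, one_mul]
    rw [← tendsto_comp_neg_atTop_iff]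
  · simp [BoundarySide.sign]

theorem tendsto_twist_iff {ψ : ℝ → ℂ} {l : Filter ℝ} (lam : ℝ) :
    Tendsto (fun x : ℝ => Complex.exp (-(Complex.I * lam) * x) * ψ x) l (𝓝 0) ↔
      Tendsto ψ l (𝓝 0) := by
  rw [tendsto_zero_iff_norm_tendsto_zero, tendsto_zero_iff_norm_tendsto_zero (f := ψ)]
  simp only [norm_mul]
  have e : ∀ x : ℝ, ‖Complex.exp (-(Complex.I * lam) * x)‖ = 1 := fun x => by
    rw [show -(Complex.I * lam) * x = ((-(lam * x) : ℝ) : ℂ) * Complex.I by push_cast; ring,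
      Complex.norm_exp_ofReal_mul_I]
  simp only [e, one_mul]

theorem exp_mul_exp_neg_cancel (z : ℂ) : Complex.exp z * Complex.exp (-z) = 1 := by
  rw [← Complex.exp_add]; simp

/-- The kernel from above integrates over `(-∞, x)` and so gives decay at `-∞`; the one from below
integrates over `(x, ∞)` and gives decay at `+∞`. -/
theorem freeResolvent_solves {F : ℝ → ℂ} (hF : Integrable F) (σ : BoundarySide) (lam : ℝ) :
    LocallyAC (freeResolvent σ lam F) ∧
      (∀ᵐ x : ℝ, deriv (freeResolvent σ lam F) x =
        Complex.I * (lam * freeResolvent σ lam F x + F x)) ∧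
      Tendsto (fun t : ℝ => freeResolvent σ lam F (-(σ.sign * t))) atTop (𝓝 0) := by
  have hG := integrable_twist hF lam
  cases σ
  · have e : ∀ x, freeResolvent .above lam F x = Complex.exp (Complex.I * lam * x) *
        ((∫ y in Iic (0 : ℝ), Complex.exp (-(Complex.I * lam) * y) * (Complex.I * F y)) +
          ∫ y in (0 : ℝ)..x, Complex.exp (-(Complex.I * lam) * y) * (Complex.I * F y)) := by
      intro x
      rw [freeResolvent_above, ← intervalIntegral.integral_Iic_sub_Iic hG.integrableOn
        hG.integrableOn, add_sub_cancel]
    obtain ⟨h1, h2⟩ := locallyAC_of_duhamel hF.locallyIntegrable e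
    refine ⟨h1, h2, ?_⟩
    rw [tendsto_of_side, ← tendsto_twist_iff lam]
    have h3 := (intervalIntegral_tendsto_integral_Iic 0 hG.integrableOn
      (tendsto_id (α := ℝ) (x := atBot))).const_sub
        (∫ y in Iic (0 : ℝ), Complex.exp (-(Complex.I * lam) * y) * (Complex.I * F y))
    rw [sub_self] at h3
    refine h3.congr fun x => ?_
    rw [e, ← mul_assoc, mul_comm (Complex.exp _) (Complex.exp _), neg_mul,
      exp_mul_exp_neg_cancel, one_mul, id, intervalIntegral.integral_symm, sub_neg_eq_add]
  · have e : ∀ x, freeResolvent .below lam F x = Complex.exp (Complex.I * lam * x) *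
        ((-∫ y in Ioi (0 : ℝ), Complex.exp (-(Complex.I * lam) * y) * (Complex.I * F y)) +
          ∫ y in (0 : ℝ)..x, Complex.exp (-(Complex.I * lam) * y) * (Complex.I * F y)) := by
      intro x
      rw [freeResolvent_below, ← intervalIntegral.integral_Ioi_sub_Ioi' hG.integrableOn
        hG.integrableOn]
      ring
    obtain ⟨h1, h2⟩ := locallyAC_of_duhamel hF.locallyIntegrable e
    refine ⟨h1, h2, ?_⟩
    rw [tendsto_of_side, ← tendsto_twist_iff lam]
    have h3 := (intervalIntegral_tendsto_integral_Ioi 0 hG.integrableOn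
      (tendsto_id (α := ℝ) (x := atTop))).sub_const
        (∫ y in Ioi (0 : ℝ), Complex.exp (-(Complex.I * lam) * y) * (Complex.I * F y))
    rw [sub_self] at h3
    refine h3.congr fun x => ?_
    rw [e, ← mul_assoc, mul_comm (Complex.exp _) (Complex.exp _), neg_mul,
      exp_mul_exp_neg_cancel, one_mul, id]
    ring

/-- Homogeneous solutions `c e^{iλx}` have constant modulus, so decay at one end determines the
solution: Duhamel's formula is used with one endpoint sent there. -/
theorem LocallyAC.eq_freeResolvent {ψ F : ℝ → ℂ} {lam : ℝ} (h : LocallyAC ψ) (hF : Integrable F)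
    (hd : ∀ᵐ x : ℝ, deriv ψ x = Complex.I * (lam * ψ x + F x)) (σ : BoundarySide)
    (ht : Tendsto (fun t : ℝ => ψ (-(σ.sign * t))) atTop (𝓝 0)) :
    ψ = freeResolvent σ lam F := by
  have hG := integrable_twist hF lam
  have hD := h.duhamel hF.locallyIntegrable hd
  rw [tendsto_of_side, ← tendsto_twist_iff lam] at ht
  funext x
  cases σ
  · have h1 := intervalIntegral_tendsto_integral_Iic x hG.integrableOn
      (tendsto_id (α := ℝ) (x := atBot))
    simp only [hD, id] at h1
    have h2 := tendsto_nhds_unique h1 (ht.const_sub _)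
    rw [freeResolvent_above, h2, sub_zero, ← mul_assoc, neg_mul, exp_mul_exp_neg_cancel, one_mul]
  · have h1 := intervalIntegral_tendsto_integral_Ioi x hG.integrableOn
      (tendsto_id (α := ℝ) (x := atTop))
    simp only [hD, id] at h1
    have h2 := tendsto_nhds_unique h1 (ht.sub_const _)
    rw [freeResolvent_below, h2, zero_sub, neg_neg, ← mul_assoc, neg_mul, exp_mul_exp_neg_cancel,
      one_mul]

/-- The function `e^{-iλx} ψ` has an integrable derivative, hence a limit at each end, and square
integrability forces that limit to be zero. -/
theorem LocallyAC.tendsto_zero_of_memLp {ψ F : ℝ → ℂ} {lam : ℝ} (h : LocallyAC ψ)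
    (hψ : MemLp ψ 2 volume) (hF : Integrable F)
    (hd : ∀ᵐ x : ℝ, deriv ψ x = Complex.I * (lam * ψ x + F x)) (σ : BoundarySide) :
    Tendsto (fun t : ℝ => ψ (-(σ.sign * t))) atTop (𝓝 0) := by
  have hG := integrable_twist hF lam
  have hD := h.duhamel hF.locallyIntegrable hd
  have hs : Integrable (fun x => ‖ψ x‖ ^ 2) := hψ.integrable_norm_pow (by norm_num)
  have e : ∀ x : ℝ, ‖Complex.exp (-(Complex.I * lam) * x) * ψ x‖ = ‖ψ x‖ := fun x => by
    rw [norm_mul, show -(Complex.I * lam) * x = ((-(lam * x) : ℝ) : ℂ) * Complex.I by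
      push_cast; ring, Complex.norm_exp_ofReal_mul_I, one_mul]
  rw [tendsto_of_side, ← tendsto_twist_iff lam]
  cases σ
  · have h1 := intervalIntegral_tendsto_integral_Iic 0 hG.integrableOn
      (tendsto_id (α := ℝ) (x := atBot))
    simp only [hD, id] at h1
    have h2 := h1.const_sub (Complex.exp (-(Complex.I * lam) * (0 : ℝ)) * ψ 0)
    simp only [sub_sub_cancel] at h2
    have h3 := h2.norm.pow 2
    simp only [e] at h3
    have h4 := eq_zero_of_integrable_of_tendsto_atBot hs h3
    rwa [norm_eq_zero.1 (pow_eq_zero_iff (by norm_num) |>.1 h4)] at h2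
  · have h1 := intervalIntegral_tendsto_integral_Ioi 0 hG.integrableOn
      (tendsto_id (α := ℝ) (x := atTop))
    simp only [hD, id] at h1
    have h2 := h1.add_const (Complex.exp (-(Complex.I * lam) * (0 : ℝ)) * ψ 0)
    simp only [sub_add_cancel] at h2
    have h3 := h2.norm.pow 2
    simp only [e] at h3
    have h4 := eq_zero_of_integrable_of_tendsto_atTop hs h3
    rwa [norm_eq_zero.1 (pow_eq_zero_iff (by norm_num) |>.1 h4)] at h2

/-- A solution that vanishes at `±∞` is bounded by tails of the source term. -/
theorem norm_le_integral_tail {ψ F : ℝ → ℂ} {lam : ℝ} (h : LocallyAC ψ) (hF : Integrable F)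
    (hd : ∀ᵐ x : ℝ, deriv ψ x = Complex.I * (lam * ψ x + F x))
    (ht : ∀ σ : BoundarySide, Tendsto (fun t : ℝ => ψ (-(σ.sign * t))) atTop (𝓝 0)) (x : ℝ) :
    ‖ψ x‖ ≤ ∫ y in {y : ℝ | |x| ≤ |y|}, ‖F y‖ := by
  have hm : MeasurableSet {y : ℝ | |x| ≤ |y|} := measurableSet_le measurable_const (by fun_prop)
  have key : ∀ σ : BoundarySide, (∀ y, greenKernel σ lam (x - y) ≠ 0 → |x| ≤ |y|) →
      ‖ψ x‖ ≤ ∫ y in {y : ℝ | |x| ≤ |y|}, ‖F y‖ := by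
    intro σ hσ
    rw [h.eq_freeResolvent hF hd σ (ht σ), freeResolvent, ← integral_indicator hm]
    refine norm_integral_le_of_norm_le (hF.norm.indicator hm) (Eventually.of_forall fun y => ?_)
    by_cases h0 : greenKernel σ lam (x - y) = 0
    · rw [h0, zero_mul, norm_zero]
      exact indicator_nonneg (fun _ _ => norm_nonneg _) _
    · rw [indicator_of_mem (show y ∈ {y : ℝ | |x| ≤ |y|} from hσ y h0), norm_mul]
      exact mul_le_of_le_one_left (norm_nonneg _) (norm_greenKernel_le σ lam _)
  -- The representation starting from the nearer end keeps the integration inside `|y| ≥ |x|`.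
  rcases le_total x 0 with hx | hx
  · refine key .above fun y hy => ?_
    have : y < x := by
      by_contra hc
      exact hy (by simp [greenKernel, BoundarySide.sign, not_lt.1 hc])
    rw [abs_of_nonpos hx, abs_of_nonpos (by linarith)]
    linarith
  · refine key .below fun y hy => ?_
    have : x < y := by
      by_contra hc
      exact hy (by simp [greenKernel, BoundarySide.sign, not_lt.1 hc])
    rw [abs_of_nonneg hx, abs_of_nonneg (by linarith)]
    linarith

/-! ### Weighted estimates for the Cauchy–Szegő projector -/

theorem norm_cexp_sub_one_le_rpow {ρ : ℝ} (h0 : 0 ≤ ρ) (h1 : ρ ≤ 1) (θ : ℝ) :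
    ‖Complex.exp (θ * Complex.I) - 1‖ ≤ 2 * |θ| ^ ρ := by
  have hn : ‖Complex.exp (θ * Complex.I)‖ = 1 := Complex.norm_exp_ofReal_mul_I θ
  rcases le_total 1 |θ| with h | h
  · have : (1 : ℝ) ≤ |θ| ^ ρ := Real.one_le_rpow h h0
    calc ‖Complex.exp (θ * Complex.I) - 1‖ ≤ ‖Complex.exp (θ * Complex.I)‖ + ‖(1 : ℂ)‖ :=
          norm_sub_le _ _
      _ ≤ 2 * |θ| ^ ρ := by rw [hn, norm_one]; linarith
  · have h2 : ‖Complex.exp (θ * Complex.I) - 1‖ ≤ |θ| := by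
      have := Real.norm_exp_I_mul_ofReal_sub_one_le (x := θ)
      rwa [mul_comm, Real.norm_eq_abs] at this
    have h3 : |θ| ≤ |θ| ^ ρ := by
      rcases eq_or_lt_of_le (abs_nonneg θ) with h4 | h4
      · rw [← h4]; exact Real.rpow_nonneg le_rfl _
      · calc |θ| = |θ| ^ (1 : ℝ) := (Real.rpow_one _).symm
          _ ≤ |θ| ^ ρ := Real.rpow_le_rpow_of_exponent_ge h4 h h1
    have := Real.rpow_nonneg (abs_nonneg θ) ρ
    linarith

theorem japaneseBracket_pos (x : ℝ) : 0 < japaneseBracket x := Real.sqrt_pos.2 (by positivity)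

theorem one_le_japaneseBracket (x : ℝ) : 1 ≤ japaneseBracket x :=
  Real.one_le_sqrt.2 (by nlinarith [sq_nonneg x])

theorem abs_le_japaneseBracket (x : ℝ) : |x| ≤ japaneseBracket x :=
  Real.abs_le_sqrt (by linarith)

theorem continuous_japaneseBracket : Continuous japaneseBracket := by
  unfold japaneseBracket; fun_prop

theorem modulate_sub_apply (h : ℝ) (u : L2R) :
    ∀ᵐ x : ℝ, (modulate (-h) u - u : L2R) x =
      (Complex.exp (((-(2 * Real.pi * h * x) : ℝ) : ℂ) * Complex.I) - 1) * u x := by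
  filter_upwards [coeFn_modulate (-h) u, Lp.coeFn_sub (modulate (-h) u) u] with x h1 h2
  rw [h2, Pi.sub_apply, h1, sub_mul, one_mul]
  congr 3
  push_cast; ring

/-- Trades the weight for a Hölder condition under modulation, that is, under translation of the
Fourier transform, where the projector is a cutoff. -/
theorem exists_norm_modulate_sub_le {u : L2R} {ρ : ℝ} (h0 : 0 ≤ ρ) (h1 : ρ ≤ 1)
    (hu : MemLp (fun x : ℝ => ((japaneseBracket x ^ ρ : ℝ) : ℂ) * u x) 2 volume) :
    ∃ A : ℝ, 0 ≤ A ∧ ∀ h : ℝ, 0 ≤ h → ‖modulate (-h) u - u‖ ≤ A * h ^ ρ := by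
  refine ⟨2 * (2 * Real.pi) ^ ρ * ‖hu.toLp _‖, by positivity, fun h hh => ?_⟩
  have : ‖modulate (-h) u - u‖ ≤ (2 * (2 * Real.pi * h) ^ ρ) * ‖hu.toLp _‖ := by
    refine Lp.norm_le_mul_norm_of_ae_le_mul ?_
    filter_upwards [modulate_sub_apply h u, hu.coeFn_toLp] with x h2 h3
    rw [h2, h3, norm_mul, norm_mul, ← mul_assoc]
    refine mul_le_mul_of_nonneg_right ?_ (norm_nonneg _)
    refine (norm_cexp_sub_one_le_rpow h0 h1 _).trans ?_
    rw [abs_neg, abs_mul, abs_of_nonneg (by positivity : (0 : ℝ) ≤ 2 * Real.pi * h),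
      Real.mul_rpow (by positivity) (abs_nonneg _), Complex.norm_real, Real.norm_of_nonneg
      (Real.rpow_nonneg (japaneseBracket_pos x).le _), ← mul_assoc]
    gcongr
    exact abs_le_japaneseBracket x
  rw [Real.mul_rpow (by positivity) hh] at this
  linarith

theorem integrable_norm_sq (u : L2R) : Integrable (fun x => ‖u x‖ ^ 2) :=
  (Lp.memLp u).integrable_norm_pow (by norm_num)

theorem intervalIntegral_norm_sq_le (u : L2R) {a b : ℝ} (hab : a ≤ b) :
    ∫ x in a..b, ‖u x‖ ^ 2 ≤ ‖u‖ ^ 2 := by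
  rw [norm_sq_L2R, intervalIntegral.integral_of_le hab]
  exact setIntegral_le_integral (integrable_norm_sq u) (Eventually.of_forall fun x => by positivity)

theorem fourier_modulate_sub (h : ℝ) (u : L2R) :
    ∀ᵐ ξ : ℝ, (𝓕 (modulate (-h) u - u) : L2R) ξ = (𝓕 u : L2R) (ξ + h) - (𝓕 u : L2R) ξ := by
  rw [fourier_sub_L2R]
  filter_upwards [fourier_modulate (-h) u, Lp.coeFn_sub (𝓕 (modulate (-h) u) : L2R) (𝓕 u)]
    with ξ h1 h2
  rw [h2, Pi.sub_apply, h1, sub_neg_eq_add]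

/-- The energy of low positive frequencies is controlled by that of a translated band. -/
theorem low_frequency_le_translate (u : L2R) {h : ℝ} (hh : 0 ≤ h) (t : ℝ) :
    ∫ ξ in (0 : ℝ)..h, ‖(𝓕 u : L2R) ξ‖ ^ 2 ≤
      2 * (∫ ξ in t..(t + h), ‖(𝓕 u : L2R) ξ‖ ^ 2) + 2 * ‖modulate (-t) u - u‖ ^ 2 := by
  have hi := integrable_norm_sq (𝓕 u : L2R)
  have hi' := hi.comp_add_right t
  have hd := integrable_norm_sq (𝓕 (modulate (-t) u - u) : L2R)
  have e : ∫ ξ in t..(t + h), ‖(𝓕 u : L2R) ξ‖ ^ 2 =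
      ∫ ξ in (0 : ℝ)..h, ‖(𝓕 u : L2R) (ξ + t)‖ ^ 2 := by
    rw [intervalIntegral.integral_comp_add_right (fun ξ => ‖(𝓕 u : L2R) ξ‖ ^ 2), zero_add,
      add_comm]
  have h1 := intervalIntegral_norm_sq_le (𝓕 (modulate (-t) u - u) : L2R) hh
  rw [Lp.norm_fourier_eq] at h1
  have h2 : ∫ ξ in (0 : ℝ)..h, ‖(𝓕 u : L2R) ξ‖ ^ 2 ≤ ∫ ξ in (0 : ℝ)..h,
      (2 * ‖(𝓕 u : L2R) (ξ + t)‖ ^ 2 + 2 * ‖(𝓕 (modulate (-t) u - u) : L2R) ξ‖ ^ 2) := by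
    refine intervalIntegral.integral_mono_ae hh hi.intervalIntegrable
      ((hi'.const_mul 2).add (hd.const_mul 2)).intervalIntegrable ?_
    filter_upwards [fourier_modulate_sub t u] with ξ h3
    rw [h3]
    set a := (𝓕 u : L2R) ξ
    set b := (𝓕 u : L2R) (ξ + t)
    have h4 : ‖a‖ ≤ ‖b‖ + ‖b - a‖ := by
      have := norm_sub_le b (b - a)
      rwa [sub_sub_cancel] at this
    nlinarith [norm_nonneg a, sq_nonneg (‖b‖ - ‖b - a‖)]
  rw [intervalIntegral.integral_add (hi'.const_mul 2).intervalIntegrable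
    (hd.const_mul 2).intervalIntegrable, intervalIntegral.integral_const_mul,
    intervalIntegral.integral_const_mul, ← e] at h2
  linarith

/-- The bands `[jh, (j+1)h]` with `1 ≤ j ≤ N` tile `[h, (N+1)h]`. Comparing `[0, h]` with each and
adding gains a factor `N`. -/
theorem low_frequency_le_dilate {u : L2R} {ρ A : ℝ} (h0 : 0 ≤ ρ) (hA : 0 ≤ A)
    (hu : ∀ h : ℝ, 0 ≤ h → ‖modulate (-h) u - u‖ ≤ A * h ^ ρ) (N : ℕ) {h : ℝ} (hh : 0 ≤ h) :
    N * ∫ ξ in (0 : ℝ)..h, ‖(𝓕 u : L2R) ξ‖ ^ 2 ≤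
      2 * (∫ ξ in (0 : ℝ)..((N + 1) * h), ‖(𝓕 u : L2R) ξ‖ ^ 2) +
        N * (2 * (A * (N * h) ^ ρ) ^ 2) := by
  have hi := integrable_norm_sq (𝓕 u : L2R)
  have h1 : ∀ j ∈ Finset.range N, ∫ ξ in (0 : ℝ)..h, ‖(𝓕 u : L2R) ξ‖ ^ 2 ≤
      2 * (∫ ξ in (((j + 1 : ℕ) : ℝ) * h)..(((j + 1 + 1 : ℕ) : ℝ) * h), ‖(𝓕 u : L2R) ξ‖ ^ 2) +
        2 * (A * (N * h) ^ ρ) ^ 2 := by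
    intro j hj
    have h2 := low_frequency_le_translate u hh (((j + 1 : ℕ) : ℝ) * h)
    rw [show ((j + 1 : ℕ) : ℝ) * h + h = ((j + 1 + 1 : ℕ) : ℝ) * h by push_cast; ring] at h2
    have h3 : ((j + 1 : ℕ) : ℝ) ≤ N := by exact_mod_cast Finset.mem_range.1 hj
    have h4 : ‖modulate (-(((j + 1 : ℕ) : ℝ) * h)) u - u‖ ≤ A * (N * h) ^ ρ := by
      refine (hu _ (by positivity)).trans ?_
      gcongr
    have h5 : ‖modulate (-(((j + 1 : ℕ) : ℝ) * h)) u - u‖ ^ 2 ≤ (A * (N * h) ^ ρ) ^ 2 := by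
      gcongr
    linarith
  have h2 := Finset.sum_le_sum h1
  rw [Finset.sum_const, Finset.card_range, nsmul_eq_mul, Finset.sum_add_distrib, Finset.sum_const,
    Finset.card_range, nsmul_eq_mul, ← Finset.mul_sum] at h2
  have h3 := intervalIntegral.sum_integral_adjacent_intervals (μ := volume)
    (f := fun ξ => ‖(𝓕 u : L2R) ξ‖ ^ 2) (a := fun j : ℕ => ((j + 1 : ℕ) : ℝ) * h) (n := N)
    (fun k _ => hi.intervalIntegrable)
  rw [h3] at h2
  have h4 := intervalIntegral.integral_add_adjacent_intervals (μ := volume)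
    (a := 0) (b := ((0 + 1 : ℕ) : ℝ) * h) (c := ((N + 1 : ℕ) : ℝ) * h)
    hi.intervalIntegrable hi.intervalIntegrable
  have h5 : 0 ≤ ∫ ξ in (0 : ℝ)..(((0 + 1 : ℕ) : ℝ) * h), ‖(𝓕 u : L2R) ξ‖ ^ 2 :=
    intervalIntegral.integral_nonneg (by positivity) fun x _ => by positivity
  push_cast at h2 h4 h5
  linarith

/-- The threshold `1/2` originates here: `(N+1)^{2ρ}` is of lower order than `N`. The factor `4`
lets the doubled term in `low_frequency_le_dilate` cost only half of the bound. -/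
theorem exists_nat_rpow_le {ρ : ℝ} (h1 : ρ < 1 / 2) :
    ∃ N : ℕ, 0 < N ∧ 4 * ((N : ℝ) + 1) ^ (2 * ρ) ≤ N := by
  have h2 : Tendsto (fun n : ℕ => ((n : ℝ) + 1) ^ (2 * ρ - 1)) atTop (𝓝 0) := by
    have h3 := tendsto_rpow_neg_atTop (y := 1 - 2 * ρ) (by linarith)
    have h4 := h3.comp (tendsto_atTop_add_const_right atTop (1 : ℝ) tendsto_natCast_atTop_atTop)
    refine h4.congr fun n => ?_
    simp only [Function.comp, neg_sub]
  obtain ⟨n, hn, hn1⟩ := ((h2.eventually_lt_const (u := 1 / 8) (by norm_num)).and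
    (eventually_ge_atTop 1)).exists
  refine ⟨n, hn1, ?_⟩
  have hp : (0 : ℝ) < (n : ℝ) + 1 := by positivity
  rw [Real.rpow_sub_one hp.ne', div_lt_iff₀ hp] at hn
  have : (1 : ℝ) ≤ n := by exact_mod_cast hn1
  linarith

/-- A fractional Hardy inequality on the Fourier side. -/
theorem exists_low_frequency_le {u : L2R} {ρ A : ℝ} (h0 : 0 ≤ ρ) (h1 : ρ < 1 / 2) (hA : 0 ≤ A)
    (hu : ∀ h : ℝ, 0 ≤ h → ‖modulate (-h) u - u‖ ≤ A * h ^ ρ) :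
    ∃ K : ℝ, 0 ≤ K ∧ ∀ h : ℝ, 0 < h →
      ∫ ξ in (0 : ℝ)..h, ‖(𝓕 u : L2R) ξ‖ ^ 2 ≤ K * h ^ (2 * ρ) := by
  obtain ⟨N, hN, hN4⟩ := exists_nat_rpow_le h1
  have hNr : (0 : ℝ) < N := by exact_mod_cast hN
  set c : ℝ := A ^ 2 * (N : ℝ) ^ (2 * ρ)
  -- Half of `K` is left after the dilation step and must absorb `2c`, whence `4c`; the term `‖u‖²`
  -- settles scales `h ≥ 1`, from which the induction descends by factors `N + 1`.
  refine ⟨‖u‖ ^ 2 + 4 * c, by positivity, ?_⟩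
  have key : ∀ n : ℕ, ∀ h : ℝ, 0 < h → 1 ≤ h * ((N : ℝ) + 1) ^ n →
      ∫ ξ in (0 : ℝ)..h, ‖(𝓕 u : L2R) ξ‖ ^ 2 ≤ (‖u‖ ^ 2 + 4 * c) * h ^ (2 * ρ) := by
    intro n
    induction n with
    | zero =>
      intro h hh h2
      rw [pow_zero, mul_one] at h2
      have h3 := intervalIntegral_norm_sq_le (𝓕 u : L2R) hh.le
      rw [Lp.norm_fourier_eq] at h3
      have h4 : (1 : ℝ) ≤ h ^ (2 * ρ) := Real.one_le_rpow h2 (by linarith)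
      have h5 : 0 ≤ ‖u‖ ^ 2 := by positivity
      have h6 : 0 ≤ c := by positivity
      nlinarith
    | succ n ih =>
      intro h hh h2
      have h3 := ih ((N + 1) * h) (by positivity) (by rw [pow_succ] at h2; linarith)
      have h4 := low_frequency_le_dilate h0 hA hu N hh.le
      rw [Real.mul_rpow (by positivity) hh.le] at h3
      have h5 : (A * (N * h) ^ ρ) ^ 2 = c * h ^ (2 * ρ) := by
        rw [mul_pow, ← Real.rpow_natCast ((N * h) ^ ρ), ← Real.rpow_mul (by positivity),
          Real.mul_rpow hNr.le hh.le]
        simp only [c]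
        push_cast
        rw [mul_comm ρ 2]; ring
      rw [h5] at h4
      have h6 : 0 ≤ (‖u‖ ^ 2 + 4 * c) * h ^ (2 * ρ) := by positivity
      have h7 := mul_le_mul_of_nonneg_right hN4 h6
      have h8 : 0 ≤ N * (‖u‖ ^ 2 * h ^ (2 * ρ)) := by positivity
      refine le_of_mul_le_mul_left ?_ hNr
      nlinarith
  intro h hh
  obtain ⟨n, hn⟩ := pow_unbounded_of_one_lt (1 / h) (by linarith : (1 : ℝ) < N + 1)
  refine key n h hh ?_
  rw [div_lt_iff₀ hh] at hn
  linarith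

/-- Modulation by `-h` lowers frequencies by `h`. Cutting before or after it differs only on `[-h,
0)`, which holds the frequencies of `u` from `[0, h)`. -/
theorem norm_sq_commutator_le (u : L2R) {h : ℝ} (hh : 0 ≤ h) :
    ‖modulate (-h) (cauchySzego u) - cauchySzego (modulate (-h) u)‖ ^ 2 ≤
      ∫ ξ in (0 : ℝ)..h, ‖(𝓕 u : L2R) ξ‖ ^ 2 := by
  have hi := integrable_norm_sq (𝓕 u : L2R)
  have e : ∫ ξ in (0 : ℝ)..h, ‖(𝓕 u : L2R) ξ‖ ^ 2 =
      ∫ ξ, (Ioc (-h) 0).indicator (fun ξ => ‖(𝓕 u : L2R) (ξ + h)‖ ^ 2) ξ := by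
    rw [integral_indicator measurableSet_Ioc, ← intervalIntegral.integral_of_le (by linarith),
      intervalIntegral.integral_comp_add_right (fun ξ => ‖(𝓕 u : L2R) ξ‖ ^ 2), zero_add,
      neg_add_cancel]
  rw [← Lp.norm_fourier_eq, norm_sq_L2R, e]
  refine integral_mono_ae (integrable_norm_sq _)
    ((hi.comp_add_right h).indicator measurableSet_Ioc) ?_
  have h1 : ∀ᵐ ξ : ℝ, (𝓕 (cauchySzego u) : L2R) (ξ - -h) =
      (Ici (0 : ℝ)).indicator (𝓕 u : L2R) (ξ - -h) :=
    (measurePreserving_sub_right volume (-h)).quasiMeasurePreserving.ae (fourier_cauchySzego u)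
  have h6 : ∀ᵐ ξ : ℝ, ξ ≠ -h := by simp [ae_iff, measure_singleton]
  rw [fourier_sub_L2R]
  filter_upwards [h1, fourier_modulate (-h) (cauchySzego u), fourier_modulate (-h) u,
    fourier_cauchySzego (modulate (-h) u),
    Lp.coeFn_sub (𝓕 (modulate (-h) (cauchySzego u)) : L2R) (𝓕 (cauchySzego (modulate (-h) u))), h6]
    with ξ h1 h2 h3 h4 h5 h6
  rw [h5, Pi.sub_apply, h2, h4, h1]
  simp only [indicator, mem_Ici, mem_Ioc, h3, sub_neg_eq_add]
  by_cases ha : 0 ≤ ξ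
  · rw [if_pos (by linarith), if_pos ha, sub_self, norm_zero, zero_pow two_ne_zero]
    split_ifs <;> first | exact le_rfl | positivity
  · by_cases hb : 0 ≤ ξ + h
    · rw [if_pos hb, if_neg ha, sub_zero, if_pos ⟨lt_of_le_of_ne (by linarith) (Ne.symm h6),
        by linarith⟩]
    · rw [if_neg hb, if_neg ha, sub_self, norm_zero, zero_pow two_ne_zero]
      split_ifs <;> first | exact le_rfl | positivity

/-- The projector preserves fractional `L²`-moments below order `1/2`. -/
theorem exists_norm_modulate_cauchySzego_sub_le {u : L2R} {ρ A : ℝ} (h0 : 0 ≤ ρ) (h1 : ρ < 1 / 2)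
    (hA : 0 ≤ A) (hu : ∀ h : ℝ, 0 ≤ h → ‖modulate (-h) u - u‖ ≤ A * h ^ ρ) :
    ∃ B : ℝ, 0 ≤ B ∧ ∀ h : ℝ, 0 < h →
      ‖modulate (-h) (cauchySzego u) - cauchySzego u‖ ≤ B * h ^ ρ := by
  obtain ⟨K, hK, hE⟩ := exists_low_frequency_le h0 h1 hA hu
  refine ⟨Real.sqrt K + A, by positivity, fun h hh => ?_⟩
  have h2 : ‖modulate (-h) (cauchySzego u) - cauchySzego (modulate (-h) u)‖ ≤
      Real.sqrt K * h ^ ρ := by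
    refine abs_le_of_sq_le_sq' ?_ (by positivity) |>.2
    refine (norm_sq_commutator_le u hh.le).trans ((hE h hh).trans (le_of_eq ?_))
    rw [mul_pow, Real.sq_sqrt hK, ← Real.rpow_natCast (h ^ ρ), ← Real.rpow_mul hh.le]
    push_cast
    rw [mul_comm ρ 2]
  have h3 : ‖cauchySzego (modulate (-h) u - u)‖ ≤ A * h ^ ρ :=
    (norm_cauchySzego_le _).trans (hu h hh.le)
  calc ‖modulate (-h) (cauchySzego u) - cauchySzego u‖
      = ‖(modulate (-h) (cauchySzego u) - cauchySzego (modulate (-h) u)) +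
          cauchySzego (modulate (-h) u - u)‖ := by rw [map_sub]; congr 1; abel
    _ ≤ Real.sqrt K * h ^ ρ + A * h ^ ρ := (norm_add_le _ _).trans (add_le_add h2 h3)
    _ = _ := by ring

/-! ### Decay of solutions -/

theorem measurableSet_le_abs (R : ℝ) : MeasurableSet {x : ℝ | R ≤ |x|} :=
  measurableSet_le measurable_const (by fun_prop)

/-- The choice `h = 1/(4R)` puts the phase in `[π/2, π)` up to sign, where the cosine is
nonpositive. -/
theorem one_le_norm_cexp_sub_one {R x : ℝ} (hR : 0 < R) (h1 : R ≤ |x|) (h2 : |x| < 2 * R) :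
    1 ≤ ‖Complex.exp (((-(2 * Real.pi * (1 / (4 * R)) * x) : ℝ) : ℂ) * Complex.I) - 1‖ := by
  set θ : ℝ := -(2 * Real.pi * (1 / (4 * R)) * x) with hθ
  have hcos : Real.cos θ ≤ 0 := by
    have e : |θ| = Real.pi / 2 * (|x| / R) := by
      rw [hθ, abs_neg, abs_mul, abs_of_pos (by positivity)]
      field_simp; ring
    rw [← Real.cos_abs]
    have h3 : 1 ≤ |x| / R := (one_le_div hR).2 h1
    have h4 : |x| / R ≤ 2 := (div_le_iff₀ hR).2 h2.le
    refine Real.cos_nonpos_of_pi_div_two_le_of_le ?_ ?_ <;> rw [e] <;> nlinarith [Real.pi_pos]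
  have h3 : |(Complex.exp (θ * Complex.I) - 1).re| ≤ ‖Complex.exp (θ * Complex.I) - 1‖ :=
    Complex.abs_re_le_norm _
  rw [Complex.sub_re, Complex.exp_ofReal_mul_I_re, Complex.one_re] at h3
  have h4 := neg_le_abs (Real.cos θ - 1)
  linarith

/-- On the shell `R ≤ |x| < 2R`, modulation by `-1/(4R)` displaces `w` by at least `‖w x‖`, so the
shell is controlled by the Hölder condition. -/
theorem integral_dyadic_le {w : L2R} {ρ B : ℝ}
    (hw : ∀ h : ℝ, 0 < h → ‖modulate (-h) w - w‖ ≤ B * h ^ ρ) {R : ℝ} (hR : 0 < R) :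
    ∫ x in {x : ℝ | R ≤ |x|} \ {x : ℝ | 2 * R ≤ |x|}, ‖w x‖ ^ 2 ≤
      (B * (1 / 4) ^ ρ) ^ 2 * (R ^ (-ρ)) ^ 2 := by
  have h1 := hw (1 / (4 * R)) (by positivity)
  have hm := (measurableSet_le_abs R).diff (measurableSet_le_abs (2 * R))
  have h2 : ∫ x in {x : ℝ | R ≤ |x|} \ {x : ℝ | 2 * R ≤ |x|}, ‖w x‖ ^ 2 ≤
      ‖modulate (-(1 / (4 * R))) w - w‖ ^ 2 := by
    rw [norm_sq_L2R, ← integral_indicator hm]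
    refine integral_mono_ae ((integrable_norm_sq w).indicator hm) (integrable_norm_sq _) ?_
    filter_upwards [modulate_sub_apply (1 / (4 * R)) w] with x hx
    rw [hx, norm_mul]
    by_cases hxm : x ∈ {x : ℝ | R ≤ |x|} \ {x : ℝ | 2 * R ≤ |x|}
    · rw [indicator_of_mem hxm]
      have h3 := one_le_norm_cexp_sub_one hR hxm.1 (not_le.1 hxm.2)
      gcongr
      exact le_mul_of_one_le_left (norm_nonneg _) h3
    · rw [indicator_of_notMem hxm]; positivity
  refine h2.trans ?_
  rw [← mul_pow]
  gcongr
  refine h1.trans (le_of_eq ?_)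
  rw [mul_assoc, Real.rpow_neg hR.le, ← Real.inv_rpow hR.le, ← Real.mul_rpow (by positivity)
    (by positivity)]
  congr 2
  field_simp

theorem tendsto_integral_tail {f : ℝ → ℝ} (hf : Integrable f) {R : ℝ} (hR : 0 < R) :
    Tendsto (fun n : ℕ => ∫ x in {x : ℝ | 2 ^ n * R ≤ |x|}, f x) atTop (𝓝 0) := by
  have h1 : ⋂ n : ℕ, {x : ℝ | 2 ^ n * R ≤ |x|} = ∅ := by
    ext x
    simp only [mem_iInter, mem_ofPred_eq, mem_empty_iff_false, iff_false, not_forall, not_le]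
    obtain ⟨n, hn⟩ := pow_unbounded_of_one_lt (|x| / R) (by norm_num : (1 : ℝ) < 2)
    exact ⟨n, (div_lt_iff₀ hR).1 hn⟩
  have h2 := tendsto_setIntegral_of_antitone (μ := volume) (f := f)
    (s := fun n : ℕ => {x : ℝ | 2 ^ n * R ≤ |x|}) (fun n => measurableSet_le_abs _)
    (by
      intro m n hmn x hx
      refine le_trans ?_ (mem_ofPred_eq ▸ hx)
      gcongr
      norm_num) ⟨0, hf.integrableOn⟩
  rwa [h1, setIntegral_empty] at h2

theorem exists_integral_tail_le_of_modulate {w : L2R} {ρ B : ℝ} (h0 : 0 < ρ)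
    (hw : ∀ h : ℝ, 0 < h → ‖modulate (-h) w - w‖ ≤ B * h ^ ρ) :
    ∃ C : ℝ, 0 ≤ C ∧ ∀ R : ℝ, 0 < R →
      ∫ x in {x : ℝ | R ≤ |x|}, ‖w x‖ ^ 2 ≤ (C * R ^ (-ρ)) ^ 2 := by
  set c : ℝ := (B * (1 / 4) ^ ρ) ^ 2 with hc
  set θ : ℝ := ((2 : ℝ) ^ (-ρ)) ^ 2 with hθ
  have hθ1 : θ < 1 := by
    have h1 : (2 : ℝ) ^ (-ρ) < 1 := Real.rpow_lt_one_of_one_lt_of_neg (by norm_num) (by linarith)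
    have h2 : 0 ≤ (2 : ℝ) ^ (-ρ) := by positivity
    exact pow_lt_one₀ h2 h1 two_ne_zero
  have hc0 : 0 ≤ c := by positivity
  have hK0 : 0 ≤ c / (1 - θ) := div_nonneg hc0 (by linarith)
  have hi := integrable_norm_sq w
  -- Shells are peeled off one at a time. `K = c/(1-θ)`, the geometric sum with ratio `θ = 2^{-2ρ}`,
  -- satisfies `Kθ + c = K`, and the remaining tail tends to zero.
  have key : ∀ n : ℕ, ∀ R : ℝ, 0 < R → ∫ x in {x : ℝ | R ≤ |x|}, ‖w x‖ ^ 2 ≤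
      c / (1 - θ) * (R ^ (-ρ)) ^ 2 + ∫ x in {x : ℝ | 2 ^ n * R ≤ |x|}, ‖w x‖ ^ 2 := by
    intro n
    induction n with
    | zero =>
      intro R hR
      rw [pow_zero, one_mul]
      have : 0 ≤ c / (1 - θ) * (R ^ (-ρ)) ^ 2 := by positivity
      linarith
    | succ n ih =>
      intro R hR
      have h1 := ih (2 * R) (by positivity)
      have h2 := integral_dyadic_le hw hR
      rw [setIntegral_sdiff (measurableSet_le_abs _) hi.integrableOn (by
        intro x hx
        have : 2 * R ≤ |x| := hx
        show R ≤ |x|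
        linarith), ← hc] at h2
      rw [Real.mul_rpow (by norm_num) hR.le, mul_pow, ← hθ, ← mul_assoc (2 ^ n), ← pow_succ] at h1
      have h3 : c / (1 - θ) * (θ * (R ^ (-ρ)) ^ 2) + c * (R ^ (-ρ)) ^ 2 =
          c / (1 - θ) * (R ^ (-ρ)) ^ 2 := by
        have : 1 - θ ≠ 0 := by linarith
        field_simp; ring
      linarith
  refine ⟨Real.sqrt (c / (1 - θ)), by positivity, fun R hR => ?_⟩
  rw [mul_pow, Real.sq_sqrt hK0]
  have h4 := (tendsto_integral_tail hi hR).const_add (c / (1 - θ) * (R ^ (-ρ)) ^ 2)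
  rw [add_zero] at h4
  exact ge_of_tendsto' h4 fun n => key n R hR

theorem exists_integral_tail_cauchySzego_le {u : L2R} {ρ : ℝ} (h0 : 0 < ρ) (h1 : ρ < 1 / 2)
    (hu : MemLp (fun x : ℝ => ((japaneseBracket x ^ ρ : ℝ) : ℂ) * u x) 2 volume) :
    ∃ C : ℝ, 0 ≤ C ∧ ∀ R : ℝ, 0 < R →
      ∫ x in {x : ℝ | R ≤ |x|}, ‖cauchySzego u x‖ ^ 2 ≤ (C * R ^ (-ρ)) ^ 2 := by
  obtain ⟨A, hA, h2⟩ := exists_norm_modulate_sub_le h0.le (by linarith) hu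
  obtain ⟨B, _, h3⟩ := exists_norm_modulate_cauchySzego_sub_le h0.le h1 hA h2
  exact exists_integral_tail_le_of_modulate h0 h3

theorem exists_integral_tail_le_of_weighted {q : L2R} {s : ℝ} (hs : 0 ≤ s)
    (hq : MemLp (fun x : ℝ => ((japaneseBracket x ^ s : ℝ) : ℂ) * q x) 2 volume) :
    ∃ C : ℝ, 0 ≤ C ∧ ∀ R : ℝ, 0 < R →
      ∫ x in {x : ℝ | R ≤ |x|}, ‖q x‖ ^ 2 ≤ (C * R ^ (-s)) ^ 2 := by
  refine ⟨‖hq.toLp _‖, norm_nonneg _, fun R hR => ?_⟩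
  have hm := measurableSet_le_abs R
  rw [mul_pow, norm_sq_L2R, ← integral_mul_const, ← integral_indicator hm]
  refine integral_mono_ae ((integrable_norm_sq q).indicator hm)
    ((integrable_norm_sq _).mul_const _) ?_
  filter_upwards [hq.coeFn_toLp] with x hx
  rw [hx]
  by_cases hxm : x ∈ {x : ℝ | R ≤ |x|}
  · rw [indicator_of_mem hxm, norm_mul, Complex.norm_real,
      Real.norm_of_nonneg (Real.rpow_nonneg (japaneseBracket_pos x).le _), ← mul_pow]
    have h1 : R ^ s ≤ japaneseBracket x ^ s :=
      Real.rpow_le_rpow hR.le (le_trans hxm (abs_le_japaneseBracket x)) hs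
    have h2 : 1 ≤ japaneseBracket x ^ s * R ^ (-s) := by
      calc (1 : ℝ) = R ^ s * R ^ (-s) := by rw [← Real.rpow_add hR, add_neg_cancel, Real.rpow_zero]
        _ ≤ _ := by gcongr
    gcongr
    calc ‖q x‖ = 1 * ‖q x‖ := (one_mul _).symm
      _ ≤ (japaneseBracket x ^ s * R ^ (-s)) * ‖q x‖ := by gcongr
      _ = _ := by ring
  · rw [indicator_of_notMem hxm]; positivity

theorem setIntegral_norm_mul_le (f g : L2R) {S : Set ℝ} {a b : ℝ}
    (ha : 0 ≤ a) (hb : 0 ≤ b) (hfa : ∫ x in S, ‖f x‖ ^ 2 ≤ a ^ 2)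
    (hgb : ∫ x in S, ‖g x‖ ^ 2 ≤ b ^ 2) : ∫ x in S, ‖f x * g x‖ ≤ a * b := by
  have h := integral_mul_le_Lp_mul_Lq_of_nonneg (μ := volume.restrict S) Real.HolderConjugate.two_two
    (f := fun x => ‖f x‖) (g := fun x => ‖g x‖) (Eventually.of_forall fun x => norm_nonneg _)
    (Eventually.of_forall fun x => norm_nonneg _)
    (by simpa using ((Lp.memLp f).restrict S).norm) (by simpa using ((Lp.memLp g).restrict S).norm)
  simp only [Real.rpow_two, ← Real.sqrt_eq_rpow, ← norm_mul] at h
  refine h.trans (mul_le_mul ?_ ?_ (Real.sqrt_nonneg _) ha)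
  · exact Real.sqrt_le_iff.2 ⟨ha, hfa⟩
  · exact Real.sqrt_le_iff.2 ⟨hb, hgb⟩

/-! ### The decay bootstrap. -/

theorem japaneseBracket_le_two_mul_abs {x : ℝ} (hx : 1 ≤ |x|) : japaneseBracket x ≤ 2 * |x| := by
  refine Real.sqrt_le_iff.2 ⟨by positivity, ?_⟩
  rw [mul_pow, sq_abs]
  have : 1 ≤ x ^ 2 := by rw [← sq_abs]; nlinarith
  linarith

theorem japaneseBracket_le_two {x : ℝ} (hx : |x| ≤ 1) : japaneseBracket x ≤ 2 := by
  refine Real.sqrt_le_iff.2 ⟨by norm_num, ?_⟩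
  have : x ^ 2 ≤ 1 := by rw [← sq_abs]; nlinarith [abs_nonneg x]
  linarith

/-- One step of the decay bootstrap. -/
theorem decay_improve {s r ρ M lam : ℝ} (hs : 0 ≤ s) {q u : L2R} {ψ : ℝ → ℂ}
    (hq : MemLp (fun x : ℝ => ((japaneseBracket x ^ s : ℝ) : ℂ) * q x) 2 volume)
    (h : LocallyAC ψ) (hM : ∀ x, ‖ψ x‖ ≤ M)
    (hu : ∀ᵐ x : ℝ, u x = conj (q x) * ψ x)
    (hd : ∀ᵐ x : ℝ, deriv ψ x = Complex.I * (lam * ψ x + q x * cauchySzego u x))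
    (ht : ∀ σ : BoundarySide, Tendsto (fun t : ℝ => ψ (-(σ.sign * t))) atTop (𝓝 0))
    (hr : ∃ C : ℝ, ∀ x, ‖ψ x‖ ≤ C * japaneseBracket x ^ (-r))
    (hρ0 : 0 < ρ) (hρ : ρ < 1 / 2) (hρr : ρ ≤ s + r) :
    ∃ C : ℝ, ∀ x, ‖ψ x‖ ≤ C * japaneseBracket x ^ (-(s + ρ)) := by
  obtain ⟨C, hC⟩ := hr
  -- The current decay of `ψ` gives `⟨x⟩^ρ |u| ≤ C ⟨x⟩^{ρ-r} |q| ≤ C ⟨x⟩^s |q|`.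
  have hu2 : MemLp (fun x : ℝ => ((japaneseBracket x ^ ρ : ℝ) : ℂ) * u x) 2 volume := by
    refine hq.of_le_mul (c := C) ?_ ?_
    · have hc : Continuous fun x : ℝ => ((japaneseBracket x ^ ρ : ℝ) : ℂ) :=
        Complex.continuous_ofReal.comp (continuous_japaneseBracket.rpow_const
          fun x => Or.inl (japaneseBracket_pos x).ne')
      exact hc.aestronglyMeasurable.mul (Lp.aestronglyMeasurable u)
    · filter_upwards [hu] with x hx
      have hp := japaneseBracket_pos x
      rw [hx, norm_mul, norm_mul, norm_mul, RCLike.norm_conj, Complex.norm_real, Complex.norm_real,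
        Real.norm_of_nonneg (by positivity), Real.norm_of_nonneg (by positivity)]
      have h1 : japaneseBracket x ^ ρ * japaneseBracket x ^ (-r) ≤ japaneseBracket x ^ s := by
        rw [← Real.rpow_add hp]
        exact Real.rpow_le_rpow_of_exponent_le (one_le_japaneseBracket x) (by linarith)
      have hC0 : 0 ≤ C := by
        by_contra hneg
        have h2 : 0 < japaneseBracket x ^ (-r) := by positivity
        have := (norm_nonneg _).trans (hC x)
        nlinarith
      calc japaneseBracket x ^ ρ * (‖q x‖ * ‖ψ x‖)
          ≤ japaneseBracket x ^ ρ * (‖q x‖ * (C * japaneseBracket x ^ (-r))) := by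
            gcongr; exact hC x
        _ = C * ((japaneseBracket x ^ ρ * japaneseBracket x ^ (-r)) * ‖q x‖) := by ring
        _ ≤ C * (japaneseBracket x ^ s * ‖q x‖) := by gcongr
  obtain ⟨C1, hC1, h1⟩ := exists_integral_tail_cauchySzego_le hρ0 hρ hu2
  obtain ⟨C2, hC2, h2⟩ := exists_integral_tail_le_of_weighted hs hq
  have hM0 : 0 ≤ M := (norm_nonneg _).trans (hM 0)
  -- `C2 * C1` serves `|x| ≥ 1`, where `⟨x⟩ ≤ 2|x|`, and `M` serves `|x| ≤ 1`, where `⟨x⟩ ≤ 2`.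
  refine ⟨(C2 * C1 + M) * 2 ^ (s + ρ), fun x => ?_⟩
  have hp := japaneseBracket_pos x
  rw [Real.rpow_neg hp.le]
  rcases le_total 1 |x| with hx | hx
  · have hx0 : 0 < |x| := by linarith
    have h3 := norm_le_integral_tail h (integrable_mul_L2R q (cauchySzego u)) hd ht x
    have h4 := setIntegral_norm_mul_le q (cauchySzego u) (by positivity) (by positivity)
      (h2 |x| hx0) (h1 |x| hx0)
    have h5 : (|x| ^ (s + ρ))⁻¹ ≤ 2 ^ (s + ρ) * (japaneseBracket x ^ (s + ρ))⁻¹ := by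
      rw [← div_eq_mul_inv, le_div_iff₀ (by positivity), inv_mul_le_iff₀ (by positivity),
        mul_comm, ← Real.mul_rpow (by norm_num) (abs_nonneg x)]
      exact Real.rpow_le_rpow hp.le (japaneseBracket_le_two_mul_abs hx) (by linarith)
    calc ‖ψ x‖ ≤ C2 * |x| ^ (-s) * (C1 * |x| ^ (-ρ)) := h3.trans h4
      _ = C2 * C1 * (|x| ^ (s + ρ))⁻¹ := by
        rw [Real.rpow_add hx0, Real.rpow_neg hx0.le, Real.rpow_neg hx0.le, mul_inv]; ring
      _ ≤ (C2 * C1 + M) * (2 ^ (s + ρ) * (japaneseBracket x ^ (s + ρ))⁻¹) := by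
        gcongr; linarith
      _ = _ := by ring
  · have h5 : 1 ≤ 2 ^ (s + ρ) * (japaneseBracket x ^ (s + ρ))⁻¹ := by
      rw [← div_eq_mul_inv, le_div_iff₀ (by positivity), one_mul]
      exact Real.rpow_le_rpow hp.le (japaneseBracket_le_two hx) (by linarith)
    calc ‖ψ x‖ ≤ M * 1 := by rw [mul_one]; exact hM x
      _ ≤ (C2 * C1 + M) * (2 ^ (s + ρ) * (japaneseBracket x ^ (s + ρ))⁻¹) := by
        gcongr
        have : 0 ≤ C2 * C1 := by positivity
        linarith
      _ = _ := by ring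

theorem decay_mono {ψ : ℝ → ℂ} {r r' : ℝ} (h : r' ≤ r)
    (hr : ∃ C : ℝ, ∀ x, ‖ψ x‖ ≤ C * japaneseBracket x ^ (-r)) :
    ∃ C : ℝ, ∀ x, ‖ψ x‖ ≤ C * japaneseBracket x ^ (-r') := by
  obtain ⟨C, hC⟩ := hr
  refine ⟨C, fun x => (hC x).trans ?_⟩
  have hp := japaneseBracket_pos x
  have hC0 : 0 ≤ C := by
    by_contra hneg
    have h2 : 0 < japaneseBracket x ^ (-r) := by positivity
    have := (norm_nonneg _).trans (hC x)
    nlinarith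
  gcongr
  exact one_le_japaneseBracket x

/-- A bootstrap step replaces the exponent `r` by `s + min (s + r) (1/2 - δ)`. Below the cap this
gains `2s`; the induction records only a gain of `s`, which reaches `s + 1/2 - δ` after finitely
many steps. -/
theorem exists_decay {s M lam : ℝ} (hs : 0 < s) {q u : L2R} {ψ : ℝ → ℂ}
    (hq : MemLp (fun x : ℝ => ((japaneseBracket x ^ s : ℝ) : ℂ) * q x) 2 volume)
    (h : LocallyAC ψ) (hM : ∀ x, ‖ψ x‖ ≤ M)
    (hu : ∀ᵐ x : ℝ, u x = conj (q x) * ψ x)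
    (hd : ∀ᵐ x : ℝ, deriv ψ x = Complex.I * (lam * ψ x + q x * cauchySzego u x))
    (ht : ∀ σ : BoundarySide, Tendsto (fun t : ℝ => ψ (-(σ.sign * t))) atTop (𝓝 0))
    {ε : ℝ} (hε : 0 < ε) :
    ∃ C : ℝ, ∀ x, ‖ψ x‖ ≤ C * japaneseBracket x ^ (-s - 1 / 2 + ε) := by
  set δ := min ε (1 / 4) with hδ
  have hδ0 : 0 < δ := lt_min hε (by norm_num)
  have hδ1 : δ ≤ 1 / 4 := min_le_right _ _
  have key : ∀ n : ℕ, ∃ C : ℝ, ∀ x, ‖ψ x‖ ≤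
      C * japaneseBracket x ^ (-(min (n * s) (s + (1 / 2 - δ)))) := by
    intro n
    induction n with
    | zero =>
      refine ⟨M, fun x => ?_⟩
      have : min ((0 : ℕ) * s) (s + (1 / 2 - δ)) = 0 := by
        rw [Nat.cast_zero, zero_mul]; exact min_eq_left (by linarith)
      rw [this, neg_zero, Real.rpow_zero, mul_one]
      exact hM x
    | succ n ih =>
      have hn : 0 ≤ (n : ℝ) * s := by positivity
      have hmin : 0 ≤ min (n * s) (s + (1 / 2 - δ)) := le_min hn (by linarith)
      have h1 := decay_improve (ρ := min (s + min (n * s) (s + (1 / 2 - δ))) (1 / 2 - δ)) hs.le hq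
        h hM hu hd ht ih (lt_min (by linarith) (by linarith))
        ((min_le_right _ _).trans_lt (by linarith)) (min_le_left _ _)
      refine decay_mono ?_ h1
      push_cast
      rcases le_total (n * s) (s + (1 / 2 - δ)) with h2 | h2
      · rw [min_eq_left h2, ← min_add_add_left]
        refine min_le_min ?_ le_rfl
        linarith
      · rw [min_eq_right h2, min_eq_right (by linarith : 1 / 2 - δ ≤ s + (s + (1 / 2 - δ)))]
        exact min_le_right _ _
  obtain ⟨n, hn⟩ := exists_nat_ge ((s + (1 / 2 - δ)) / s)
  rw [div_le_iff₀ hs] at hn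
  have h1 := key n
  rw [min_eq_right hn] at h1
  have h2 := decay_mono (r' := s + 1 / 2 - ε) (by linarith [min_le_left ε (1 / 4)]) h1
  rwa [show -(s + 1 / 2 - ε) = -s - 1 / 2 + ε by ring] at h2

theorem memLp_of_decay {ψ : ℝ → ℂ} (hc : Continuous ψ) {r : ℝ} (hr : 1 / 2 < r)
    (h : ∃ C : ℝ, ∀ x, ‖ψ x‖ ≤ C * japaneseBracket x ^ (-r)) : MemLp ψ 2 volume := by
  obtain ⟨C, hC⟩ := h
  have h1 : MemLp (fun x => japaneseBracket x ^ (-r)) 2 volume := by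
    have hcj : Continuous fun x => japaneseBracket x ^ (-r) :=
      continuous_japaneseBracket.rpow_const fun x => Or.inl (japaneseBracket_pos x).ne'
    rw [memLp_two_iff_integrable_sq hcj.aestronglyMeasurable]
    have h2 := integrable_rpow_neg_one_add_norm_sq (E := ℝ) (μ := volume) (r := 2 * r)
      (by simp; linarith)
    refine h2.congr (Eventually.of_forall fun x => ?_)
    simp only [japaneseBracket, Real.sqrt_eq_rpow, Real.norm_eq_abs, sq_abs]
    rw [← Real.rpow_mul (by positivity), ← Real.rpow_mul_natCast (by positivity)]
    congr 1
    push_cast; ring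
  refine h1.of_le_mul (c := C) hc.aestronglyMeasurable (Eventually.of_forall fun x => ?_)
  rw [Real.norm_of_nonneg (Real.rpow_nonneg (japaneseBracket_pos x).le _)]
  exact hC x

/-! ### The resolvent of `-i∂ₓ` off the real axis -/

/-- The kernel `k(t) = 1_{t<0} e^{κt}`. -/
def dampedKernel (κ t : ℝ) : ℝ := (Iio (0 : ℝ)).indicator (fun t => Real.exp (κ * t)) t

theorem dampedKernel_nonneg (κ t : ℝ) : 0 ≤ dampedKernel κ t :=
  indicator_nonneg (fun _ _ => (Real.exp_pos _).le) _

theorem dampedKernel_le_one {κ : ℝ} (hκ : 0 < κ) (t : ℝ) : dampedKernel κ t ≤ 1 := by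
  unfold dampedKernel
  by_cases h : t < 0
  · rw [indicator_of_mem (mem_Iio.2 h)]
    exact Real.exp_le_one_iff.2 (by nlinarith)
  · rw [indicator_of_notMem (by simpa using h)]
    exact zero_le_one

theorem measurable_dampedKernel (κ : ℝ) : Measurable (dampedKernel κ) :=
  (Continuous.measurable (by fun_prop)).indicator measurableSet_Iio

theorem integral_dampedKernel {κ : ℝ} (hκ : 0 < κ) : ∫ t, dampedKernel κ t = κ⁻¹ := by
  unfold dampedKernel
  rw [integral_indicator measurableSet_Iio, ← integral_Iic_eq_integral_Iio]
  have := integral_exp_mul_Iic hκ 0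
  simpa using this

theorem integrable_dampedKernel {κ : ℝ} (hκ : 0 < κ) : Integrable (dampedKernel κ) := by
  -- A nonintegrable function has integral `0` by convention, whereas this integral is `κ⁻¹`.
  by_contra h
  have := integral_undef h
  rw [integral_dampedKernel hκ] at this
  exact (inv_pos.2 hκ).ne' this

/-- The resolvent `(-i∂ₓ + iκ)⁻¹` applied to `g`. -/
def dampedResolvent (κ : ℝ) (g : ℝ → ℂ) (x : ℝ) : ℂ :=
  ∫ y, (-Complex.I * dampedKernel κ (x - y)) * g y

theorem integrable_dampedKernel_mul_norm_sq {κ : ℝ} (hκ : 0 < κ) (g : L2R) (x : ℝ) :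
    Integrable (fun y => dampedKernel κ (x - y) * ‖g y‖ ^ 2) :=
  (integrable_norm_sq g).bdd_mul (c := 1)
    ((measurable_dampedKernel κ).comp (by fun_prop)).aestronglyMeasurable
    (Eventually.of_forall fun y => by
      rw [Real.norm_of_nonneg (dampedKernel_nonneg _ _)]; exact dampedKernel_le_one hκ _)

theorem dampedKernel_half_sq (κ t : ℝ) : dampedKernel (κ / 2) t ^ 2 = dampedKernel κ t := by
  unfold dampedKernel
  by_cases h : t < 0
  · rw [indicator_of_mem (mem_Iio.2 h), indicator_of_mem (mem_Iio.2 h), ← Real.exp_nat_mul]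
    congr 1; push_cast; ring
  · rw [indicator_of_notMem (by simpa using h), indicator_of_notMem (by simpa using h)]
    ring

theorem memLp_dampedKernel {κ : ℝ} (hκ : 0 < κ) (x : ℝ) :
    MemLp (fun y => dampedKernel κ (x - y)) 2 volume := by
  have hm : Measurable fun y => dampedKernel κ (x - y) :=
    (measurable_dampedKernel κ).comp (by fun_prop)
  rw [memLp_two_iff_integrable_sq hm.aestronglyMeasurable]
  have := (integrable_dampedKernel (by positivity : 0 < 2 * κ)).comp_sub_left x
  refine this.congr (Eventually.of_forall fun y => ?_)
  simp only
  rw [← dampedKernel_half_sq (2 * κ)]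
  congr 2; ring

theorem integrable_dampedKernel_mul {κ : ℝ} (hκ : 0 < κ) (g : L2R) (x : ℝ) :
    Integrable (fun y => (-Complex.I * dampedKernel κ (x - y)) * g y) := by
  have h1 : MemLp (fun y => -Complex.I * dampedKernel κ (x - y)) 2 volume :=
    (memLp_dampedKernel hκ x).ofReal.const_mul _
  exact h1.integrable_mul (Lp.memLp g)

/-- Cauchy–Schwarz after writing the kernel as the square of `dampedKernel (κ / 2)`; one factor
contributes the total mass `κ⁻¹`. -/
theorem norm_sq_dampedResolvent_le {κ : ℝ} (hκ : 0 < κ) (g : L2R) (x : ℝ) :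
    ‖dampedResolvent κ g x‖ ^ 2 ≤ κ⁻¹ * ∫ y, dampedKernel κ (x - y) * ‖g y‖ ^ 2 := by
  have hk := memLp_dampedKernel (half_pos hκ) x
  have hm := (measurable_dampedKernel (κ / 2)).comp (by fun_prop : Measurable fun y => x - y)
  have hkg : MemLp (fun y => dampedKernel (κ / 2) (x - y) * ‖g y‖) 2 volume :=
    (Lp.memLp g).norm.of_le (hm.aestronglyMeasurable.mul (Lp.aestronglyMeasurable g).norm)
      (Eventually.of_forall fun y => by
        rw [norm_mul, Real.norm_of_nonneg (dampedKernel_nonneg _ _)]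
        exact mul_le_of_le_one_left (norm_nonneg _) (dampedKernel_le_one (half_pos hκ) _))
  have h := integral_mul_le_Lp_mul_Lq_of_nonneg (μ := volume) Real.HolderConjugate.two_two
    (Eventually.of_forall fun y => dampedKernel_nonneg (κ / 2) (x - y))
    (Eventually.of_forall fun y => mul_nonneg (dampedKernel_nonneg (κ / 2) (x - y))
      (norm_nonneg (g y))) (by simpa using hk) (by simpa using hkg)
  simp only [Real.rpow_two, ← Real.sqrt_eq_rpow, mul_pow, dampedKernel_half_sq, ← mul_assoc,
    ← sq] at h
  rw [integral_sub_left_eq_self (dampedKernel κ) volume x, integral_dampedKernel hκ] at h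
  have h1 : ‖dampedResolvent κ g x‖ ≤ ∫ y, dampedKernel κ (x - y) * ‖g y‖ := by
    refine (norm_integral_le_integral_norm _).trans (le_of_eq ?_)
    refine integral_congr_ae (Eventually.of_forall fun y => ?_)
    simp [abs_of_nonneg (dampedKernel_nonneg _ _)]
  have h2 : 0 ≤ ∫ y, dampedKernel κ (x - y) * ‖g y‖ ^ 2 :=
    integral_nonneg fun y => mul_nonneg (dampedKernel_nonneg _ _) (by positivity)
  calc ‖dampedResolvent κ g x‖ ^ 2
      ≤ (Real.sqrt κ⁻¹ * Real.sqrt (∫ y, dampedKernel κ (x - y) * ‖g y‖ ^ 2)) ^ 2 := by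
        gcongr; exact h1.trans h
    _ = _ := by rw [mul_pow, Real.sq_sqrt (by positivity), Real.sq_sqrt h2]

theorem norm_dampedResolvent_le {κ : ℝ} (hκ : 0 < κ) (g : L2R) (x : ℝ) :
    ‖dampedResolvent κ g x‖ ≤ Real.sqrt (κ⁻¹ * ‖g‖ ^ 2) := by
  refine Real.le_sqrt_of_sq_le ((norm_sq_dampedResolvent_le hκ g x).trans ?_)
  gcongr
  rw [norm_sq_L2R]
  refine integral_mono (integrable_dampedKernel_mul_norm_sq hκ g x) (integrable_norm_sq g)
    fun y => ?_
  exact mul_le_of_le_one_left (by positivity) (dampedKernel_le_one hκ _)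

theorem dampedResolvent_eq {κ : ℝ} (g : ℝ → ℂ) (x : ℝ) :
    dampedResolvent κ g x = Complex.exp (Complex.I * -(Complex.I * κ) * x) *
      -∫ y in Ioi x, Complex.exp (-(Complex.I * -(Complex.I * κ)) * y) * (Complex.I * g y) := by
  have e : Complex.I * -(Complex.I * κ) = κ := by linear_combination (-κ : ℂ) * Complex.I_sq
  rw [e, dampedResolvent, ← integral_neg, ← integral_const_mul, ← integral_indicator measurableSet_Ioi]
  refine integral_congr_ae (Eventually.of_forall fun y => ?_)
  by_cases hy : x < y
  · simp only [dampedKernel, mem_Iio, sub_neg, hy, mem_Ioi, indicator_of_mem]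
    rw [mul_neg, ← mul_assoc (Complex.exp _), ← Complex.exp_add]
    push_cast
    ring_nf
  · simp [dampedKernel, hy]

theorem dampedResolvent_solves {κ : ℝ} (hκ : 0 < κ) (g : L2R) :
    LocallyAC (dampedResolvent κ g) ∧ ∀ᵐ x : ℝ, deriv (dampedResolvent κ g) x =
      Complex.I * (-(Complex.I * κ) * dampedResolvent κ g x + g x) := by
  have hl := (Lp.memLp g).locallyIntegrable_of_two
  have e : Complex.I * -(Complex.I * κ) = κ := by linear_combination (-κ : ℂ) * Complex.I_sq
  have hG : ∀ a : ℝ, IntegrableOn (fun y : ℝ =>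
      Complex.exp (-(Complex.I * -(Complex.I * κ)) * y) * (Complex.I * g y)) (Ioi a) := by
    intro a
    rw [← integrable_indicator_iff measurableSet_Ioi]
    refine ((integrable_dampedKernel_mul hκ g a).const_mul (-Complex.exp (-κ * a))).congr
      (Eventually.of_forall fun y => ?_)
    simp only [e]
    by_cases hy : a < y
    · simp only [dampedKernel, mem_Iio, sub_neg, hy, mem_Ioi, indicator_of_mem]
      have : Complex.exp (-κ * y) = Complex.exp (-κ * a) * (Real.exp (κ * (a - y)) : ℝ) := by
        push_cast
        rw [← Complex.exp_add]; ring_nf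
      rw [this]; ring
    · simp [dampedKernel, hy]
  refine locallyAC_of_duhamel hl (c := -∫ y in Ioi (0 : ℝ),
    Complex.exp (-(Complex.I * -(Complex.I * κ)) * y) * (Complex.I * g y)) fun x => ?_
  rw [dampedResolvent_eq, ← intervalIntegral.integral_Ioi_sub_Ioi' (hG 0) (hG x)]
  ring

theorem memLp_dampedResolvent {κ : ℝ} (hκ : 0 < κ) (g : L2R) :
    MemLp (dampedResolvent κ g) 2 volume := by
  have hc := (dampedResolvent_solves hκ g).1.continuous
  rw [memLp_two_iff_integrable_sq_norm hc.aestronglyMeasurable]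
  have h1 := (integrable_norm_sq g).integrable_convolution (ContinuousLinearMap.mul ℝ ℝ)
    (integrable_dampedKernel hκ)
  refine (h1.const_mul κ⁻¹).mono' (hc.norm.pow 2).aestronglyMeasurable
    (Eventually.of_forall fun x => ?_)
  rw [Real.norm_of_nonneg (by positivity)]
  refine (norm_sq_dampedResolvent_le hκ g x).trans (le_of_eq ?_)
  simp only [convolution, ContinuousLinearMap.mul_apply']
  congr 1
  refine integral_congr_ae (Eventually.of_forall fun y => ?_)
  simp only; ring

theorem dampedResolvent_sub {κ : ℝ} (hκ : 0 < κ) (f g : L2R) (x : ℝ) :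
    dampedResolvent κ (f - g : L2R) x = dampedResolvent κ f x - dampedResolvent κ g x := by
  unfold dampedResolvent
  rw [← integral_sub (integrable_dampedKernel_mul hκ f x) (integrable_dampedKernel_mul hκ g x)]
  refine integral_congr_ae ?_
  filter_upwards [Lp.coeFn_sub f g] with y hy
  rw [hy, Pi.sub_apply]; ring

theorem fourier_dampedResolvent {κ : ℝ} (hκ : 0 < κ) {f g : L2R}
    (hf : ∀ᵐ x : ℝ, f x = dampedResolvent κ g x) :
    ∀ᵐ ξ : ℝ, (2 * Real.pi * ξ - -(Complex.I * κ)) * (𝓕 f : L2R) ξ = (𝓕 g : L2R) ξ := by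
  obtain ⟨h1, h2⟩ := dampedResolvent_solves hκ g
  exact h1.fourier_of_equation (norm_dampedResolvent_le hκ g) hf
    (fun k => (k.memLp 2).integrable_mul (Lp.memLp g)) (Lp.memLp (𝓕 g : L2R)).locallyIntegrable_of_two
    h2 (integral_mul_fourier g)

/-! ### A supremum bound for the projected sandwich -/

theorem lintegral_mul_sq_le {α : Type*} [MeasurableSpace α] {μ : Measure α} {f g : α → ℝ≥0∞}
    (hf : AEMeasurable f μ) (hg : AEMeasurable g μ) :
    (∫⁻ x, f x * g x ∂μ) ^ 2 ≤ (∫⁻ x, f x ^ 2 ∂μ) * ∫⁻ x, g x ^ 2 ∂μ := by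
  have h := ENNReal.lintegral_mul_le_Lp_mul_Lq μ Real.HolderConjugate.two_two hf hg
  have e : ∀ x : ℝ≥0∞, (x ^ (1 / 2 : ℝ)) ^ 2 = x := fun x => by
    rw [← ENNReal.rpow_natCast, ← ENNReal.rpow_mul]; norm_num
  simp only [ENNReal.rpow_two, Pi.mul_apply] at h
  calc _ ≤ _ := pow_le_pow_left' h 2
    _ = _ := by rw [mul_pow, e, e]

theorem lintegral_Ioo_rpow {ζ : ℝ} (hζ : 0 < ζ) :
    ∫⁻ t in Ioo 0 ζ, ENNReal.ofReal (t ^ (-(1 / 2) : ℝ)) = ENNReal.ofReal (2 * ζ ^ (1 / 2 : ℝ)) := by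
  have h1 : IntervalIntegrable (fun t : ℝ => t ^ (-(1 / 2) : ℝ)) volume 0 ζ :=
    intervalIntegral.intervalIntegrable_rpow' (by norm_num)
  rw [← ofReal_integral_eq_lintegral_ofReal, ← integral_Ioc_eq_integral_Ioo,
    ← intervalIntegral.integral_of_le hζ.le, integral_rpow (Or.inl (by norm_num))]
  · congr 1
    rw [Real.zero_rpow (by norm_num)]; norm_num; ring
  · exact ((intervalIntegrable_iff_integrableOn_Ioo_of_le hζ.le).1 h1)
  · exact (ae_restrict_iff' measurableSet_Ioo).2 (Eventually.of_forall fun t ht =>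
      Real.rpow_nonneg ht.1.le _)

theorem lintegral_Ioi_rpow {t : ℝ} (ht : 0 < t) :
    ∫⁻ ζ in Ioi t, ENNReal.ofReal (2 * ζ ^ (-(3 / 2) : ℝ)) =
      ENNReal.ofReal (4 * t ^ (-(1 / 2) : ℝ)) := by
  rw [← ofReal_integral_eq_lintegral_ofReal, integral_const_mul,
    integral_Ioi_rpow_of_lt (by norm_num) ht]
  · congr 1
    norm_num; ring
  · exact (integrableOn_Ioi_rpow_of_lt (by norm_num) ht).const_mul 2
  · exact (ae_restrict_iff' measurableSet_Ioi).2 (Eventually.of_forall fun x hx =>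
      mul_nonneg zero_le_two (Real.rpow_nonneg (ht.trans hx).le _))

theorem monotone_lintegral_Ioo (a : ℝ → ℝ≥0∞) : Monotone fun ζ => ∫⁻ t in Ioo 0 ζ, a t :=
  fun _ _ h => lintegral_mono_set (Ioo_subset_Ioo_right h)

/-- Cauchy–Schwarz for `a = (a t^{1/4}) t^{-1/4}`. The power `ζ^{-3/2}` left over is integrable at
infinity with tail of order `t^{-1/2}`, cancelling `t^{1/2}` once the integrals are exchanged. -/
theorem sq_lintegral_Ioo_mul_le {a : ℝ → ℝ≥0∞} (ha : Measurable a) {ζ : ℝ} (hζ : 0 < ζ) :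
    (∫⁻ t in Ioo 0 ζ, a t) ^ 2 * ENNReal.ofReal ((ζ ^ 2)⁻¹) ≤
      ENNReal.ofReal (2 * ζ ^ (-(3 / 2) : ℝ)) *
        ∫⁻ t in Ioo 0 ζ, a t ^ 2 * ENNReal.ofReal (t ^ (1 / 2 : ℝ)) := by
  have hsq : ∀ t > (0 : ℝ), ∀ r : ℝ, ENNReal.ofReal (t ^ (r / 2)) ^ 2 = ENNReal.ofReal (t ^ r) :=
    fun t ht r => by
      rw [← ENNReal.ofReal_pow (Real.rpow_nonneg ht.le _), ← Real.rpow_mul_natCast ht.le]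
      congr 2; push_cast; ring
  have h := lintegral_mul_sq_le (μ := volume.restrict (Ioo 0 ζ))
    (f := fun t => a t * ENNReal.ofReal (t ^ (1 / 2 / 2 : ℝ)))
    (g := fun t => ENNReal.ofReal (t ^ (-(1 / 2) / 2 : ℝ)))
    (ha.mul (by fun_prop)).aemeasurable (by fun_prop)
  have e1 : ∫⁻ t in Ioo 0 ζ, a t * ENNReal.ofReal (t ^ (1 / 2 / 2 : ℝ)) *
      ENNReal.ofReal (t ^ (-(1 / 2) / 2 : ℝ)) = ∫⁻ t in Ioo 0 ζ, a t :=
    setLIntegral_congr_fun measurableSet_Ioo fun t ht => by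
      rw [mul_assoc, ← ENNReal.ofReal_mul (Real.rpow_nonneg ht.1.le _), ← Real.rpow_add ht.1]
      norm_num
  have e2 : ∫⁻ t in Ioo 0 ζ, ENNReal.ofReal (t ^ (-(1 / 2) / 2 : ℝ)) ^ 2 =
      ∫⁻ t in Ioo 0 ζ, ENNReal.ofReal (t ^ (-(1 / 2) : ℝ)) :=
    setLIntegral_congr_fun measurableSet_Ioo fun t ht => hsq t ht.1 _
  have e3 : ∫⁻ t in Ioo 0 ζ, (a t * ENNReal.ofReal (t ^ (1 / 2 / 2 : ℝ))) ^ 2 =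
      ∫⁻ t in Ioo 0 ζ, a t ^ 2 * ENNReal.ofReal (t ^ (1 / 2 : ℝ)) :=
    setLIntegral_congr_fun measurableSet_Ioo fun t ht => by
      simp only [mul_pow, hsq t ht.1]
  rw [e1, e2, e3, lintegral_Ioo_rpow hζ] at h
  calc _ ≤ (∫⁻ t in Ioo 0 ζ, a t ^ 2 * ENNReal.ofReal (t ^ (1 / 2 : ℝ))) *
        ENNReal.ofReal (2 * ζ ^ (1 / 2 : ℝ)) * ENNReal.ofReal ((ζ ^ 2)⁻¹) := by gcongr
    _ = _ := by
      rw [mul_assoc, ← ENNReal.ofReal_mul (by positivity), mul_comm]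
      congr 2
      rw [mul_assoc, ← Real.rpow_natCast, ← Real.rpow_neg hζ.le, ← Real.rpow_add hζ]
      norm_num

/-- Hardy's inequality. -/
theorem lintegral_hardy_le {a : ℝ → ℝ≥0∞} (ha : Measurable a) :
    ∫⁻ ζ in Ioi (0 : ℝ), (∫⁻ t in Ioo 0 ζ, a t) ^ 2 * ENNReal.ofReal ((ζ ^ 2)⁻¹) ≤
      4 * ∫⁻ t, a t ^ 2 := by
  set F : ℝ → ℝ≥0∞ := fun t => a t ^ 2 * ENNReal.ofReal (t ^ (1 / 2 : ℝ)) with hF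
  set G : ℝ → ℝ≥0∞ := fun ζ => ENNReal.ofReal (2 * ζ ^ (-(3 / 2) : ℝ)) with hG
  have hFm : Measurable F := (ha.pow_const 2).mul (by fun_prop)
  have hGm : Measurable G := by fun_prop
  have hmm : Measurable fun p : ℝ × ℝ => {p : ℝ × ℝ | 0 < p.2 ∧ p.2 < p.1}.indicator
      (fun p => G p.1 * F p.2) p :=
    ((hGm.comp measurable_fst).mul (hFm.comp measurable_snd)).indicator
      ((measurableSet_lt measurable_const measurable_snd).inter
        (measurableSet_lt measurable_snd measurable_fst))
  calc _ ≤ ∫⁻ ζ in Ioi (0 : ℝ), G ζ * ∫⁻ t in Ioo 0 ζ, F t :=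
        setLIntegral_mono' measurableSet_Ioi fun ζ hζ => sq_lintegral_Ioo_mul_le ha hζ
    _ ≤ ∫⁻ ζ, G ζ * ∫⁻ t in Ioo 0 ζ, F t := setLIntegral_le_lintegral _ _
    _ = ∫⁻ ζ, ∫⁻ t, {p : ℝ × ℝ | 0 < p.2 ∧ p.2 < p.1}.indicator
          (fun p => G p.1 * F p.2) (ζ, t) := by
        refine lintegral_congr fun ζ => ?_
        rw [← lintegral_const_mul _ hFm, ← lintegral_indicator measurableSet_Ioo]
        rfl
    _ = ∫⁻ t, ∫⁻ ζ, {p : ℝ × ℝ | 0 < p.2 ∧ p.2 < p.1}.indicator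
          (fun p => G p.1 * F p.2) (ζ, t) := lintegral_lintegral_swap hmm.aemeasurable
    _ ≤ ∫⁻ t, 4 * a t ^ 2 := by
        refine lintegral_mono fun t => ?_
        by_cases ht : 0 < t
        · have e : (fun ζ => {p : ℝ × ℝ | 0 < p.2 ∧ p.2 < p.1}.indicator
              (fun p => G p.1 * F p.2) (ζ, t)) = (Ioi t).indicator fun ζ => G ζ * F t := by
            funext ζ
            simp [indicator, ht]
          simp only [e]
          rw [lintegral_indicator measurableSet_Ioi, lintegral_mul_const _ hGm,
            lintegral_Ioi_rpow ht]
          simp only [hF]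
          rw [mul_comm (a t ^ 2), ← mul_assoc,
            ← ENNReal.ofReal_mul (by positivity), mul_assoc, ← Real.rpow_add ht]
          norm_num
        · simp [indicator, ht]
    _ = _ := lintegral_const_mul _ (ha.pow_const 2)

theorem setLIntegral_Iic_eq_Ioo {a : ℝ → ℝ≥0∞} (h : ∀ᵐ t : ℝ, t < 0 → a t = 0) (ζ : ℝ) :
    ∫⁻ t in Iic ζ, a t = ∫⁻ t in Ioo 0 ζ, a t := by
  rw [← lintegral_indicator measurableSet_Iic, ← lintegral_indicator measurableSet_Ioo]
  have h0 : ∀ᵐ t : ℝ, t ≠ 0 := by simp [ae_iff, measure_singleton]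
  have h1 : ∀ᵐ t : ℝ, t ≠ ζ := by simp [ae_iff, measure_singleton]
  refine lintegral_congr_ae ?_
  filter_upwards [h, h0, h1] with t ht ht0 ht1
  rcases lt_or_gt_of_ne ht0 with h | h
  · simp [indicator, ht h]
  · by_cases h2 : t ≤ ζ
    · simp [indicator, h, h2, lt_of_le_of_ne h2 ht1]
    · simp [indicator, h2, show ¬ t < ζ from fun h3 => h2 h3.le]

theorem lintegral_enorm_sq_L2R (f : L2R) : ∫⁻ x, ‖f x‖ₑ ^ 2 = ENNReal.ofReal (‖f‖ ^ 2) := by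
  rw [norm_sq_L2R, ofReal_integral_eq_lintegral_ofReal (integrable_norm_sq f)
    (Eventually.of_forall fun x => by positivity)]
  refine lintegral_congr fun x => ?_
  rw [ENNReal.ofReal_pow (norm_nonneg _), ofReal_norm]

/-- The quantity controlling `C₊ q̄ (-i∂ₓ + iκ)⁻¹` as a map from `L²` to `L^∞`. -/
theorem exists_lintegral_damped_le (q : L2R) {δ : ℝ} (hδ : 0 < δ) :
    ∃ κ : ℝ, 0 < κ ∧ ∫⁻ ζ, (∫⁻ t in Ioo 0 ζ, ‖q t‖ₑ) ^ 2 *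
      ENNReal.ofReal (((2 * Real.pi * ζ) ^ 2 + κ ^ 2)⁻¹) ≤ ENNReal.ofReal δ := by
  set A : ℝ → ℝ≥0∞ := fun ζ => ∫⁻ t in Ioo 0 ζ, ‖q t‖ₑ with hA
  have hAm : Measurable A := (monotone_lintegral_Ioo _).measurable
  have hqm : Measurable fun t => ‖q t‖ₑ := (Lp.stronglyMeasurable q).measurable.enorm
  have hfin : ∫⁻ ζ in Ioi (0 : ℝ), A ζ ^ 2 * ENNReal.ofReal ((ζ ^ 2)⁻¹) ≠ ∞ := by
    refine ne_top_of_le_ne_top ?_ (lintegral_hardy_le hqm)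
    rw [lintegral_enorm_sq_L2R]
    exact ENNReal.mul_ne_top (by norm_num) ENNReal.ofReal_ne_top
  have hae := ae_lt_top ((hAm.pow_const 2).mul (by fun_prop)) hfin
  -- Dominated convergence as `κ = n + 1` grows. The majorant is the integrand of Hardy's
  -- inequality, since `(2πζ)² ≥ ζ²`.
  have hlim : Tendsto (fun n : ℕ => ∫⁻ ζ in Ioi (0 : ℝ), A ζ ^ 2 *
      ENNReal.ofReal (((2 * Real.pi * ζ) ^ 2 + ((n : ℝ) + 1) ^ 2)⁻¹)) atTop
      (𝓝 (∫⁻ ζ in Ioi (0 : ℝ), 0)) := by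
    refine tendsto_lintegral_of_dominated_convergence
      (fun ζ => A ζ ^ 2 * ENNReal.ofReal ((ζ ^ 2)⁻¹))
      (fun n => (hAm.pow_const 2).mul (by fun_prop)) (fun n => ?_) hfin ?_
    · refine (ae_restrict_iff' measurableSet_Ioi).2 (Eventually.of_forall fun ζ hζ => ?_)
      have hζ : 0 < ζ := hζ
      simp only
      gcongr
      have : 1 ≤ 2 * Real.pi := by linarith [Real.pi_gt_three]
      have h2 : ζ ^ 2 ≤ (2 * Real.pi * ζ) ^ 2 := by gcongr; nlinarith
      nlinarith [sq_nonneg ((n : ℝ) + 1)]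
    · filter_upwards [hae, ae_restrict_mem measurableSet_Ioi] with ζ h1 hζ
      have hζ : 0 < ζ := hζ
      have h2 : A ζ ^ 2 ≠ ∞ := fun h => by
        rw [Pi.mul_apply, h, ENNReal.top_mul (by simpa using hζ.ne')] at h1
        exact lt_irrefl _ h1
      have h3 : Tendsto (fun n : ℕ => ((2 * Real.pi * ζ) ^ 2 + ((n : ℝ) + 1) ^ 2)⁻¹) atTop
          (𝓝 0) := by
        refine tendsto_inv_atTop_zero.comp (tendsto_atTop_add_const_left _ _ ?_)
        exact (tendsto_pow_atTop two_ne_zero).comp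
          (tendsto_atTop_add_const_right _ _ tendsto_natCast_atTop_atTop)
      have h4 := ENNReal.Tendsto.const_mul (ENNReal.tendsto_ofReal h3) (Or.inr h2)
      simpa using h4
  rw [lintegral_zero] at hlim
  obtain ⟨n, hn⟩ := (hlim.eventually (eventually_le_nhds (ENNReal.ofReal_pos.2 hδ))).exists
  refine ⟨n + 1, by positivity, le_trans (le_of_eq ?_) hn⟩
  rw [← lintegral_indicator measurableSet_Ioi]
  refine lintegral_congr fun ζ => ?_
  by_cases hζ : 0 < ζ
  · simp [indicator, hζ, hA]
  · simp [indicator, hζ]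

/-- For `η ≥ 0` the transform of `u` is a correlation containing `𝓕 q (ζ - η)`. With `t = ζ - η`,
the projector gives `t ≤ ζ` and the Hardy condition gives `t ≥ 0`; Tonelli does the rest. -/
theorem lintegral_enorm_fourier_cauchySzego_le {q f u : L2R} (hq : q ∈ hardySpace)
    (hu : ∀ᵐ x : ℝ, u x = conj (q x) * f x) :
    ∫⁻ η, ‖(𝓕 (cauchySzego u) : L2R) η‖ₑ ≤
      ∫⁻ ζ, ‖(𝓕 f : L2R) ζ‖ₑ * ∫⁻ t in Ioo 0 ζ, ‖(𝓕 q : L2R) t‖ₑ := by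
  set a : ℝ → ℝ≥0∞ := fun t => ‖(𝓕 q : L2R) t‖ₑ with ha
  have ham : Measurable a := (Lp.stronglyMeasurable _).measurable.enorm
  set b : ℝ → ℝ≥0∞ := fun t => ‖(𝓕 f : L2R) t‖ₑ with hb
  have hbm : Measurable b := (Lp.stronglyMeasurable _).measurable.enorm
  have hi : Integrable u := by
    have : Integrable (fun x => conj (q x) * f x) := (memLp_conj q).integrable_mul (Lp.memLp f)
    exact this.congr (hu.mono fun x hx => hx.symm)
  have h0 : ∀ᵐ t : ℝ, t < 0 → a t = 0 := by
    filter_upwards [hq] with t ht h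
    simp [ha, ht h]
  calc _ ≤ ∫⁻ η, ∫⁻ ζ, b ζ * (Iic ζ).indicator a (ζ - η) := by
        refine lintegral_mono_ae ?_
        filter_upwards [fourier_cauchySzego u, fourier_ae_eq_of_integrable hi] with η h1 h2
        rw [h1]
        by_cases hη : 0 ≤ η
        · rw [indicator_of_mem (mem_Ici.2 hη), h2, Real.fourier_congr_ae hu η,
            fourier_conj_mul_apply]
          refine (enorm_integral_le_lintegral_enorm _).trans (lintegral_mono fun ζ => ?_)
          rw [indicator_of_mem (by simpa using hη), enorm_mul, mul_comm]
          simp [ha, hb]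
        · simp [indicator, hη]
    _ = ∫⁻ ζ, ∫⁻ η, b ζ * (Iic ζ).indicator a (ζ - η) := by
        refine lintegral_lintegral_swap (Measurable.aemeasurable ?_)
        have e : (fun p : ℝ × ℝ => b p.2 * (Iic p.2).indicator a (p.2 - p.1)) =
            fun p : ℝ × ℝ => b p.2 * (Ici (0 : ℝ)).indicator (fun _ => a (p.2 - p.1)) p.1 := by
          funext p; simp [indicator]
        change Measurable fun p : ℝ × ℝ => b p.2 * (Iic p.2).indicator a (p.2 - p.1)
        rw [e]
        refine (hbm.comp measurable_snd).mul ?_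
        exact (ham.comp (measurable_snd.sub measurable_fst)).indicator
          (measurableSet_Ici.preimage measurable_fst)
    _ = _ := by
        refine lintegral_congr fun ζ => ?_
        have hmz : Measurable fun η => (Iic ζ).indicator a (ζ - η) :=
          (ham.indicator measurableSet_Iic).comp (by fun_prop)
        rw [lintegral_const_mul _ hmz, lintegral_sub_left_eq_self ((Iic ζ).indicator a), lintegral_indicator measurableSet_Iic,
          setLIntegral_Iic_eq_Ioo h0]

/-- Dividing `𝓕 g` by the symbol and applying Cauchy–Schwarz against `exists_lintegral_damped_le`
bounds the transform in `L¹`. The same `κ` serves every `g`, as the contraction requires. -/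
theorem exists_norm_cauchySzego_damped_le {q : L2R} (hq : q ∈ hardySpace) {δ : ℝ} (hδ : 0 < δ) :
    ∃ κ : ℝ, 0 < κ ∧ ∀ g u : L2R, (∀ᵐ x : ℝ, u x = conj (q x) * dampedResolvent κ g x) →
      ∀ᵐ x : ℝ, ‖cauchySzego u x‖ ≤ δ * ‖g‖ := by
  obtain ⟨κ, hκ, h⟩ := exists_lintegral_damped_le (𝓕 q : L2R) (pow_pos hδ 2)
  refine ⟨κ, hκ, fun g u hu => ?_⟩
  set f : L2R := (memLp_dampedResolvent hκ g).toLp _ with hf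
  have hfe : ∀ᵐ x : ℝ, f x = dampedResolvent κ g x := (memLp_dampedResolvent hκ g).coeFn_toLp
  have hu' : ∀ᵐ x : ℝ, u x = conj (q x) * f x := by
    filter_upwards [hu, hfe] with x h1 h2
    rw [h1, h2]
  set A : ℝ → ℝ≥0∞ := fun ζ => ∫⁻ t in Ioo 0 ζ, ‖(𝓕 q : L2R) t‖ₑ with hA
  have hAm : Measurable A := (monotone_lintegral_Ioo _).measurable
  set m : ℝ → ℝ := fun ζ => (2 * Real.pi * ζ) ^ 2 + κ ^ 2 with hm
  have hm0 : ∀ ζ, 0 < m ζ := fun ζ => by positivity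
  have hmm : Measurable m := by fun_prop
  have key : (∫⁻ η, ‖(𝓕 (cauchySzego u) : L2R) η‖ₑ) ^ 2 ≤ ENNReal.ofReal ((δ * ‖g‖) ^ 2) := by
    have h1 : ∫⁻ η, ‖(𝓕 (cauchySzego u) : L2R) η‖ₑ ≤
        ∫⁻ ζ, ‖(𝓕 g : L2R) ζ‖ₑ * (A ζ * ENNReal.ofReal (Real.sqrt (m ζ)⁻¹)) := by
      refine (lintegral_enorm_fourier_cauchySzego_le hq hu').trans (lintegral_mono_ae ?_)
      filter_upwards [fourier_dampedResolvent hκ hfe] with ζ h2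
      have hn : ‖(2 * Real.pi * ζ - -(Complex.I * κ) : ℂ)‖ = Real.sqrt (m ζ) := by
        rw [Complex.norm_eq_sqrt_sq_add_sq]
        simp [hm]
      have h3 : ‖(𝓕 f : L2R) ζ‖ₑ = ‖(𝓕 g : L2R) ζ‖ₑ * ENNReal.ofReal (Real.sqrt (m ζ)⁻¹) := by
        rw [← h2, enorm_mul, ← ofReal_norm (_ - _), hn, mul_right_comm,
          ← ENNReal.ofReal_mul (Real.sqrt_nonneg _), ← Real.sqrt_mul (hm0 ζ).le,
          mul_inv_cancel₀ (hm0 ζ).ne']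
        simp
      rw [h3, mul_assoc, mul_comm (ENNReal.ofReal _)]
    calc _ ≤ _ := pow_le_pow_left' h1 2
      _ ≤ _ := lintegral_mul_sq_le (Lp.stronglyMeasurable _).measurable.enorm.aemeasurable
          (hAm.mul (by fun_prop)).aemeasurable
      _ = ENNReal.ofReal (‖g‖ ^ 2) * ∫⁻ ζ, A ζ ^ 2 * ENNReal.ofReal (m ζ)⁻¹ := by
          rw [lintegral_enorm_sq_L2R, Lp.norm_fourier_eq]
          congr 1
          refine lintegral_congr fun ζ => ?_
          rw [mul_pow, ← ENNReal.ofReal_pow (Real.sqrt_nonneg _),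
            Real.sq_sqrt (inv_nonneg.2 (hm0 ζ).le)]
      _ ≤ ENNReal.ofReal (‖g‖ ^ 2) * ENNReal.ofReal (δ ^ 2) := by gcongr
      _ = _ := by rw [← ENNReal.ofReal_mul (by positivity)]; congr 1; ring
  have key' : ∫⁻ η, ‖(𝓕 (cauchySzego u) : L2R) η‖ₑ ≤ ENNReal.ofReal (δ * ‖g‖) := by
    rw [ENNReal.ofReal_pow (by positivity)] at key
    exact (ENNReal.pow_le_pow_left_iff two_ne_zero).1 key
  have hi : Integrable (𝓕 (cauchySzego u) : L2R) :=
    ⟨Lp.aestronglyMeasurable _, key'.trans_lt ENNReal.ofReal_lt_top⟩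
  filter_upwards [norm_le_integral_norm_fourier hi] with x hx
  refine hx.trans ?_
  rw [integral_norm_eq_lintegral_enorm (Lp.aestronglyMeasurable _)]
  exact ENNReal.toReal_le_of_le_ofReal (by positivity) key'

/-! ### Regularity of square integrable solutions -/

theorem memLp_conj_mul_dampedResolvent (q : L2R) {κ : ℝ} (hκ : 0 < κ) (g : L2R) :
    MemLp (fun x => conj (q x) * dampedResolvent κ g x) 2 volume := by
  have hb : MemLp (dampedResolvent κ g) ∞ volume :=
    memLp_top_of_bound (dampedResolvent_solves hκ g).1.continuous.aestronglyMeasurable _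
      (Eventually.of_forall fun x => norm_dampedResolvent_le hκ g x)
  exact MemLp.mul hb (memLp_conj q)

/-- The operator `q̄ (-i∂ₓ + iκ)⁻¹` on `L²(ℝ)`. -/
def dampedSandwich (q : L2R) {κ : ℝ} (hκ : 0 < κ) (g : L2R) : L2R :=
  (memLp_conj_mul_dampedResolvent q hκ g).toLp _

theorem coeFn_dampedSandwich (q : L2R) {κ : ℝ} (hκ : 0 < κ) (g : L2R) :
    ∀ᵐ x : ℝ, dampedSandwich q hκ g x = conj (q x) * dampedResolvent κ g x :=
  (memLp_conj_mul_dampedResolvent q hκ g).coeFn_toLp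

theorem dampedSandwich_sub (q : L2R) {κ : ℝ} (hκ : 0 < κ) (f g : L2R) :
    dampedSandwich q hκ (f - g) = dampedSandwich q hκ f - dampedSandwich q hκ g := by
  refine Lp.ext ?_
  filter_upwards [coeFn_dampedSandwich q hκ (f - g), coeFn_dampedSandwich q hκ f,
    coeFn_dampedSandwich q hκ g, Lp.coeFn_sub (dampedSandwich q hκ f) (dampedSandwich q hκ g)]
    with x h1 h2 h3 h4
  rw [h4, Pi.sub_apply, h1, h2, h3, dampedResolvent_sub hκ, mul_sub]

theorem memLp_mul_of_ae_le {q w : L2R} {c : ℝ} (h : ∀ᵐ x : ℝ, ‖w x‖ ≤ c) :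
    MemLp (fun x => q x * w x) 2 volume :=
  MemLp.mul (memLp_top_of_bound (Lp.aestronglyMeasurable w) c h) (Lp.memLp q)

/-- For `κ` large, `-i∂ₓ - q C₊ q̄ + iκ` maps onto `L²(ℝ)`. -/
theorem exists_damped_solution {q : L2R} (hq : q ∈ hardySpace) :
    ∃ (κ : ℝ) (hκ : 0 < κ), ∀ h : L2R, ∃ g : L2R,
      ∀ᵐ x : ℝ, g x = h x + q x * cauchySzego (dampedSandwich q hκ g) x := by
  -- Chosen so that `‖q‖ δ ≤ 1/2`, the contraction constant; the `+ 1` allows `q = 0`.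
  set δ : ℝ := (2 * (‖q‖ + 1))⁻¹ with hδ
  have hδ0 : 0 < δ := by positivity
  have hδq : ‖q‖ * δ ≤ 1 / 2 := by
    rw [hδ, ← div_eq_mul_inv, div_le_div_iff₀ (by positivity) (by norm_num)]
    linarith
  obtain ⟨κ, hκ, hb⟩ := exists_norm_cauchySzego_damped_le hq hδ0
  refine ⟨κ, hκ, fun h => ?_⟩
  have hb' : ∀ g : L2R, ∀ᵐ x : ℝ, ‖cauchySzego (dampedSandwich q hκ g) x‖ ≤ δ * ‖g‖ :=
    fun g => hb g _ (coeFn_dampedSandwich q hκ g)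
  let S : L2R → L2R := fun g => (memLp_mul_of_ae_le (q := q) (hb' g)).toLp _
  have hS : ∀ g, ∀ᵐ x : ℝ, S g x = q x * cauchySzego (dampedSandwich q hκ g) x := fun g =>
    (memLp_mul_of_ae_le (q := q) (hb' g)).coeFn_toLp
  have hT : ContractingWith (1 / 2) fun g => h + S g := by
    refine ⟨by norm_num, LipschitzWith.of_dist_le_mul fun f g => ?_⟩
    have h1 : ∀ᵐ x : ℝ, ‖(S f - S g : L2R) x‖ ≤ (δ * ‖f - g‖) * ‖q x‖ := by
      filter_upwards [hS f, hS g, hb' (f - g), Lp.coeFn_sub (S f) (S g),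
        Lp.coeFn_sub (cauchySzego (dampedSandwich q hκ f)) (cauchySzego (dampedSandwich q hκ g))]
        with x h1 h2 h3 h4 h5
      rw [dampedSandwich_sub, map_sub, h5, Pi.sub_apply] at h3
      rw [h4, Pi.sub_apply, h1, h2, ← mul_sub, norm_mul, mul_comm]
      gcongr
    have h2 := Lp.norm_le_mul_norm_of_ae_le_mul h1
    rw [dist_add_left, dist_eq_norm, dist_eq_norm]
    refine h2.trans ?_
    have h3 : ((1 / 2 : NNReal) : ℝ) = 1 / 2 := by norm_num
    rw [h3]
    nlinarith [norm_nonneg (f - g), mul_le_mul_of_nonneg_right hδq (norm_nonneg (f - g))]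
  refine ⟨ContractingWith.fixedPoint _ hT, ?_⟩
  have hfix := hT.fixedPoint_isFixedPt
  set g := ContractingWith.fixedPoint _ hT
  have hfix : h + S g = g := hfix
  filter_upwards [Lp.coeFn_add h (S g), hS g] with x h1 h2
  rw [← h2, ← Pi.add_apply, ← h1, hfix]

/-- Both `ψ` and `dampedResolvent κ g` solve the damped equation with right side `(λ + iκ)ψ`, so
`eq_zero_of_im_neg` identifies them. The derivative is then read from `-i∂ψ + iκψ = g` with `g ∈
L²`, without the product `q C₊ u`. -/
theorem LocallyAC.memLp_deriv {ψ : ℝ → ℂ} {lam : ℝ} {q u : L2R} (h : LocallyAC ψ)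
    (hq : q ∈ hardySpace) (hψ : MemLp ψ 2 volume) (hu : ∀ᵐ x : ℝ, u x = conj (q x) * ψ x)
    (hd : ∀ᵐ x : ℝ, deriv ψ x = Complex.I * (lam * ψ x + q x * cauchySzego u x)) :
    MemLp (deriv ψ) 2 volume := by
  obtain ⟨κ, hκ, hex⟩ := exists_damped_solution hq
  have hψm := hψ.const_mul ((lam : ℂ) + Complex.I * κ)
  obtain ⟨g, hg⟩ := hex (hψm.toLp _)
  obtain ⟨h1, h2⟩ := dampedResolvent_solves hκ g
  have hχ : (fun x => ψ x - dampedResolvent κ g x) = 0 := by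
    refine eq_zero_of_im_neg hκ (q := q) (u := u - dampedSandwich q hκ g) (h.sub h1)
      (hψ.sub (memLp_dampedResolvent hκ g)) ?_ ?_
    · filter_upwards [hu, coeFn_dampedSandwich q hκ g, Lp.coeFn_sub u (dampedSandwich q hκ g)]
        with x h3 h4 h5
      rw [h5, Pi.sub_apply, h3, h4, mul_sub]
    · filter_upwards [hd, h2, hg, hψm.coeFn_toLp, h.ae_differentiableAt, h1.ae_differentiableAt,
        Lp.coeFn_sub (cauchySzego u) (cauchySzego (dampedSandwich q hκ g))]
        with x h3 h4 h5 h6 h7 h8 h9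
      rw [map_sub, h9, Pi.sub_apply, deriv_fun_sub h7 h8, h3, h4, h5, h6]
      ring
  have e : ψ = dampedResolvent κ g := funext fun x => sub_eq_zero.1 (congrFun hχ x)
  have hm : MemLp (fun x => Complex.I * (-(Complex.I * κ) * ψ x + g x)) 2 volume :=
    ((hψ.const_mul _).add (Lp.memLp g)).const_mul _
  refine hm.ae_eq ?_
  rw [← e] at h2
  exact h2.mono fun x hx => hx.symm

/-! ### Eigenfunctions and boundary solutions -/

theorem deriv_eq_iff_laxExpr (d q w l : ℂ) :
    -Complex.I * d - q * w = l ↔ d = Complex.I * (l + q * w) := by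
  constructor
  · intro h
    rw [← h]
    linear_combination d * Complex.I_sq
  · rintro rfl
    linear_combination (-(l + q * w)) * Complex.I_sq

/-- Vanishing at one end passes to the other because `‖ψ t‖² - ‖ψ (-t)‖²` tends to zero. This is
also why the two exceptional sets coincide. -/
theorem tendsto_zero_of_boundarySolution {ψ : ℝ → ℂ} {lam : ℝ} {q u : L2R} (h : LocallyAC ψ)
    (hu : ∀ᵐ x : ℝ, u x = conj (q x) * ψ x)
    (hd : ∀ᵐ x : ℝ, deriv ψ x = Complex.I * (lam * ψ x + q x * cauchySzego u x))
    {σ : BoundarySide} (ht : Tendsto (fun t : ℝ => ψ (-(σ.sign * t))) atTop (𝓝 0))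
    (τ : BoundarySide) : Tendsto (fun t : ℝ => ψ (-(τ.sign * t))) atTop (𝓝 0) := by
  have hn := tendsto_norm_sq_sub h hu hd
  have h1 := (ht.norm.pow 2)
  have key : ∀ f : ℝ → ℂ, Tendsto (fun t => ‖f t‖ ^ 2) atTop (𝓝 0) → Tendsto f atTop (𝓝 0) := by
    intro f hf
    have := hf.sqrt
    simp only [Real.sqrt_sq (norm_nonneg _), Real.sqrt_zero] at this
    exact tendsto_zero_iff_norm_tendsto_zero.2 this
  refine key _ ?_
  cases σ <;> cases τ <;>
    simp only [BoundarySide.sign, one_mul, neg_mul, neg_neg, norm_zero, ne_eq, OfNat.ofNat_ne_zero,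
      not_false_eq_true, zero_pow] at h1 ⊢
  · exact h1
  · simpa using hn.add h1
  · simpa using h1.sub hn
  · exact h1

theorem mem_laxGraph_of_memLp {ψ : ℝ → ℂ} {lam M : ℝ} {q : L2R} (hq : q ∈ hardySpace)
    (hM : ∀ x, ‖ψ x‖ ≤ M) (h : HasLaxExpr q ψ (fun x => lam * ψ x)) (hψ : MemLp ψ 2 volume) :
    (hψ.toLp ψ, (lam : ℂ) • hψ.toLp ψ) ∈ laxGraph q := by
  obtain ⟨hac, u, hu, he⟩ := h
  have hd := he.mono fun x hx => (deriv_eq_iff_laxExpr _ _ _ _).1 hx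
  refine ⟨ψ, ⟨hac, hac.memLp_deriv hq hψ hu hd, hψ, ?_⟩, hψ.coeFn_toLp, hac, u, hu, ?_⟩
  · exact hac.mem_hardySpace hM hψ.coeFn_toLp hq (cauchySzego_mem u) hd
  · filter_upwards [he, Lp.coeFn_smul (lam : ℂ) (hψ.toLp ψ), hψ.coeFn_toLp] with x h1 h2 h3
    rw [h1, h2, Pi.smul_apply, h3, smul_eq_mul]

theorem decay_and_mem_laxGraph_of_boundarySolution {s : ℝ} (hs : 0 < s) {q : L2R}
    (hq : q ∈ weightedHardySpace s) {σ : BoundarySide} {lam : ℝ} {ψ : ℝ → ℂ}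
    (hψ : ψ ∈ boundarySolutions q σ lam) :
    (∀ ε > 0, ∃ C : ℝ, ∀ x : ℝ, ‖ψ x‖ ≤ C * japaneseBracket x ^ (-s - 1 / 2 + ε)) ∧
      ∃ hψ : MemLp ψ 2 volume, (hψ.toLp ψ, (lam : ℂ) • hψ.toLp ψ) ∈ laxGraph q := by
  obtain ⟨⟨M, hM⟩, h, ht⟩ := hψ
  obtain ⟨hac, u, hu, he⟩ := id h
  have hd := he.mono fun x hx => (deriv_eq_iff_laxExpr _ _ _ _).1 hx
  have hdecay : ∀ ε > 0, ∃ C : ℝ, ∀ x, ‖ψ x‖ ≤ C * japaneseBracket x ^ (-s - 1 / 2 + ε) :=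
    fun ε hε => exists_decay hs hq.2 hac hM hu hd (tendsto_zero_of_boundarySolution hac hu hd ht) hε
  have hm : MemLp ψ 2 volume := by
    -- Taking `ε = s/2` leaves the exponent `-1/2 - s/2`, which is square integrable because `s >
    -- 0`.
    refine memLp_of_decay hac.continuous (r := 1 / 2 + s / 2) (by linarith) ?_
    obtain ⟨C, hC⟩ := hdecay (s / 2) (by positivity)
    refine ⟨C, fun x => (hC x).trans (le_of_eq ?_)⟩
    congr 2; ring
  exact ⟨hdecay, hm, mem_laxGraph_of_memLp hq.1 hM h hm⟩

theorem boundaryOperator_apply (q : L2R) (σ : BoundarySide) (lam : ℝ) (g : L2R) :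
    boundaryOperator q σ lam g = cauchySzego (sandwichedResolvent q σ lam (cauchySzego g)) := rfl

theorem coeFn_sandwichedResolvent (q : L2R) (σ : BoundarySide) (lam : ℝ) (g : L2R) :
    ∀ᵐ x : ℝ, sandwichedResolvent q σ lam g x =
      conj (q x) * freeResolvent σ lam (fun y => q y * g y) x :=
  (memLp_conj_mul_freeResolvent q σ lam g).coeFn_toLp

theorem freeResolvent_mem_boundarySolutions {q g : L2R} {σ : BoundarySide} {lam : ℝ}
    (hg : cauchySzego (sandwichedResolvent q σ lam g) = g) :
    freeResolvent σ lam (fun y => q y * g y) ∈ boundarySolutions q σ lam := by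
  have hi := integrable_mul_L2R q g
  obtain ⟨h1, h2, h3⟩ := freeResolvent_solves hi σ lam
  refine ⟨⟨_, fun x => norm_freeResolvent_le σ lam x hi⟩, ⟨h1, _,
    coeFn_sandwichedResolvent q σ lam g, ?_⟩, h3⟩
  rw [hg]
  filter_upwards [h2] with x hx
  exact (deriv_eq_iff_laxExpr _ _ _ _).2 hx

/-- A kernel element satisfies `C₊ g = g`, so `ψ = R₀ q g` is a boundary solution and therefore in
the domain. It is nonzero, since `g = C₊ q̄ ψ`. -/
theorem mem_laxPointSpectrum_of_ker_ne_bot {s : ℝ} (hs : 0 < s) {q : L2R}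
    (hq : q ∈ weightedHardySpace s) {σ : BoundarySide} {lam : ℝ}
    (h : LinearMap.ker (1 - boundaryOperator q σ lam) ≠ ⊥) :
    (lam : ℂ) ∈ laxPointSpectrum q := by
  obtain ⟨g, hg, hg0⟩ := (Submodule.ne_bot_iff _).1 h
  have hg1 : g = cauchySzego (sandwichedResolvent q σ lam (cauchySzego g)) := by
    rw [← boundaryOperator_apply]
    simpa [sub_eq_zero] using hg
  have hg2 : cauchySzego g = g := by
    rw [hg1]
    exact cauchySzego_eq_self (cauchySzego_mem _)
  rw [hg2] at hg1
  obtain ⟨-, hm, hG⟩ := decay_and_mem_laxGraph_of_boundarySolution hs hq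
    (freeResolvent_mem_boundarySolutions hg1.symm)
  refine ⟨hm.toLp _, fun h0 => hg0 ?_, hG⟩
  have hu : sandwichedResolvent q σ lam g = 0 := by
    refine Lp.ext ?_
    filter_upwards [coeFn_sandwichedResolvent q σ lam g, hm.coeFn_toLp,
      (Lp.eq_zero_iff_ae_eq_zero).1 h0, Lp.coeFn_zero ℂ 2 (volume : Measure ℝ)] with x h1 h2 h3 h4
    rw [h1, ← h2, h3, h4, Pi.zero_apply, mul_zero]
  rw [hg1, hu, map_zero]

/-- The kernel element is `C₊ u` with `u = q̄ φ`. If it were zero, `φ = R₀ (q C₊ u)` would vanish.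
-/
theorem ker_ne_bot_of_mem_laxPointSpectrum {q : L2R} {lam : ℝ}
    (h : (lam : ℂ) ∈ laxPointSpectrum q) (σ : BoundarySide) :
    LinearMap.ker (1 - boundaryOperator q σ lam) ≠ ⊥ := by
  obtain ⟨f, hf0, φ, ⟨-, -, hφ, -⟩, hfφ, hac, u, hu, he⟩ := h
  have hfφ : ∀ᵐ x : ℝ, f x = φ x := hfφ
  have hd : ∀ᵐ x : ℝ, deriv φ x = Complex.I * (lam * φ x + q x * cauchySzego u x) := by
    filter_upwards [he, Lp.coeFn_smul (lam : ℂ) f, hfφ] with x h1 h2 h3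
    rw [(deriv_eq_iff_laxExpr _ _ _ _).1 h1, h2, Pi.smul_apply, h3, smul_eq_mul]
  have hi := integrable_mul_L2R q (cauchySzego u)
  have hφ' := hac.eq_freeResolvent hi hd σ (hac.tendsto_zero_of_memLp hφ hi hd σ)
  refine (Submodule.ne_bot_iff _).2 ⟨cauchySzego u, ?_, fun h0 => hf0 ?_⟩
  · have hS : sandwichedResolvent q σ lam (cauchySzego u) = u := by
      refine Lp.ext ?_
      filter_upwards [coeFn_sandwichedResolvent q σ lam (cauchySzego u), hu] with x h1 h2
      rw [h1, h2, ← hφ']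
    rw [LinearMap.mem_ker, LinearMap.sub_apply, Module.End.one_apply, boundaryOperator_apply,
      cauchySzego_eq_self (cauchySzego_mem u), hS, sub_self]
  · refine (Lp.eq_zero_iff_ae_eq_zero).2 ?_
    have hz : ∀ x, φ x = 0 := fun x => by
      rw [hφ', freeResolvent]
      refine integral_eq_zero_of_ae ?_
      filter_upwards [(Lp.eq_zero_iff_ae_eq_zero).1 h0] with y hy
      simp [hy]
    filter_upwards [hfφ] with x hx
    rw [hx, hz, Pi.zero_apply]

end

theorem mainTheorem9 (s : ℝ) (hs : 0 < s) (q : L2R) (hq : q ∈ weightedHardySpace s) :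
    (∀ σ : BoundarySide,
      exceptionalSet q σ = {lam : ℝ | (lam : ℂ) ∈ laxPointSpectrum q} ∩ Set.Ici 0) ∧
    (∀ (σ : BoundarySide) (lam : ℝ), ∀ ψ ∈ boundarySolutions q σ lam,
      (∀ ε > 0, ∃ C : ℝ, ∀ x : ℝ, ‖ψ x‖ ≤ C * japaneseBracket x ^ (-s - 1 / 2 + ε)) ∧
      ∃ hψ : MemLp ψ 2 volume, (hψ.toLp ψ, (lam : ℂ) • hψ.toLp ψ) ∈ laxGraph q) := by
  refine ⟨fun σ => ?_, fun σ lam ψ hψ => decay_and_mem_laxGraph_of_boundarySolution hs hq hψ⟩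
  ext lam
  exact ⟨fun h => ⟨mem_laxPointSpectrum_of_ker_ne_bot hs hq h.2, h.1⟩,
    fun h => ⟨h.2, ker_ne_bot_of_mem_laxPointSpectrum h.1 σ⟩⟩
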